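/- **Model.** Time slots are indexed by $t=0,1,2,\dots$. A *protocol in the GlobalClock model* is a family $(\mathcal D_s)_{s\in\mathbb N}$ of probability laws on infinite binary strings. A party $u$ that is woken up at global time $t_u$ draws a string $(X^{(u)}_1,X^{(u)}_2,\dots)\sim\mathcal D_{t_u}$ independently of everything else, and it grabs the shared resource in slot $t>t_u$ iff $X^{(u)}_{t-t_u}=1$ and it has not been successful before slot $t$. A party is *successful* in a slot if it is the only one that grabs in that slot; it receives no other feedback (acknowledgment-based). The protocol is *memoryless* if, for every $s$, the bits of a string with law $\mathcal D_s$ are independent. There are at most $n$ parties ($n$ is unknown to them). An *adaptive adversary* decides in each slot $t$ which sleeping parties to wake up, as a function of the complete history (wake-ups, and bits used by all awake parties) of the slots before $t$. The *latency* of $u$ is the time from its wake-up to its success. **Notation.** All logarithms are binary. $\log^{(i)}$ is the $i$-fold iterated logarithm, and $\log^* x$ is the least $i$ with $\log^{(i)}x<2$ (so $1\le\log^{(\log^*x)}x<2$ for $x\ge 1$). Let $$\zeta(x)=(2x)(2\log x)(2\log^{(2)}x)\cdots(2\log^{(\log^*x)}x).$$ For a positive integer $N$ let $\mathrm{Bin}(N)$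 be its binary representation, $N_1=N$, $N_{i+1}=\lfloor\log N_i\rfloor$, $N_k=1$, and let $\mathrm{Code}(N)=\mathrm{Bin}(N_{k-1})\cdots\mathrm{Bin}(N_1)\,0$ (Elias's $\omega$-code). For $t\in\mathbb N$ let $a(t)$ be the unique positive integer whose code is a prefix of the infinite string obtained by reversing the binary representation of $t$ and appending infinitely many zeros, and let $a'(t)=(-1)^{a(t)\bmod 2}\lfloor a(t)/2\rfloor$. **Theorem.** There is a memoryless acknowledgment-based protocol in the GlobalClock model, namely the one in which a party woken up at time $t_u$ that is not yet successful grabs the resource in slot $t>t_u$ with probability $$\min\Bigl\{\tfrac12,\ \frac{2^{a'(t)}}{t-t_u}\Bigr\},$$ that has latency $O(n\,\zeta(4\log\log n))=n(\log\log n)^{1+o(1)}$ with high probability against adaptive adversaries. Precisely: 1. $a'$ cycles through all integers: for every $z\in\mathbb Z$ there is $p$ such that every $p$ consecutive slots contain a slot $t$ with $a'(t)=z$. 2. For every $c>0$ there are $C>0$ and $n_0$ such that for all $n\ge n_0$, every adaptive adversary with at most $n$ parties, and every party $u$, with probability at least $1-n^{-c}$ the latency of $u$ (if it is ever woken up) is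 at most $C\,n\,\zeta(4\log\log n)$. 3. For every $C>0$ there is a sequence $\varepsilon(n)\to0$ such that $C\,n\,\zeta(4\log\log n)=n(\log\log n)^{1+\varepsilon(n)}$ for all sufficiently large $n$. -/

import Mathlib

open MeasureTheory ProbabilityTheory Filter Topology

namespace ContentionResolution

/-! ### Elias's omega-code -/

/-- `Bin(N)`: the binary representation of `N`, most significant bit first. -/
def bin (N : ℕ) : List Bool := (Nat.bits N).reverse

/-- `Bin(N_{k-1}) ⋯ Bin(N_2) Bin(N_1)`, where `N_1 = N`, `N_{i+1} = ⌊log₂ N_i⌋` and `N_k = 1`. -/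
def eliasGroups (N : ℕ) : List Bool :=
  if _h : 2 ≤ N then eliasGroups (Nat.log 2 N) ++ bin N else []
termination_by N
decreasing_by exact Nat.log_lt_self 2 (by omega)

/-- Elias's omega-code of a positive integer. -/
def eliasCode (N : ℕ) : List Bool := eliasGroups N ++ [false]

/-- The finite string `l` is a prefix of the infinite string `S`. -/
def IsPrefixOf (l : List Bool) (S : ℕ → Bool) : Prop :=
  ∀ (i : ℕ) (h : i < l.length), l[i] = S i

/-- The infinite string obtained by reversing the binary representation of `t` and padding
with zeros: its `i`-th symbol is the `i`-th least significant bit of `t`. -/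
def revBits (t : ℕ) : ℕ → Bool := fun i => t.testBit i

theorem isPrefixOf_append (l m : List Bool) (S : ℕ → Bool) :
    IsPrefixOf (l ++ m) S ↔ IsPrefixOf l S ∧ IsPrefixOf m (fun i => S (l.length + i)) := by
  constructor
  · intro h
    refine ⟨fun i hi => ?_, fun i hi => ?_⟩
    · have := h i (by simp; omega)
      rwa [List.getElem_append_left hi] at this
    · have := h (l.length + i) (by simp; omega)
      rw [List.getElem_append_right (by omega)] at this
      simpa using this
  · rintro ⟨h1, h2⟩ i hi
    have hi' := hi
    rw [List.length_append] at hi'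
    by_cases hl : i < l.length
    · rw [List.getElem_append_left hl]; exact h1 i hl
    · rw [List.getElem_append_right (by omega), h2 (i - l.length) (by omega)]
      simp only [Nat.add_sub_cancel' (not_lt.1 hl)]

theorem isPrefixOf_singleton (b : Bool) (S : ℕ → Bool) : IsPrefixOf [b] S ↔ b = S 0 := by
  constructor
  · intro h; exact h 0 (by simp)
  · intro h i hi
    have : i = 0 := by simpa using hi
    subst this; simpa using h

theorem bits_length (N : ℕ) (h : N ≠ 0) : (Nat.bits N).length = Nat.log 2 N + 1 := by
  rw [Nat.size_eq_bits_len]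
  refine le_antisymm (Nat.size_le.2 (Nat.lt_pow_succ_log_self (by norm_num) N)) ?_
  exact Nat.lt_size.2 (Nat.pow_log_le_self 2 h)

theorem bin_injective : Function.Injective bin := by
  intro a b h
  have h' : Nat.bits a = Nat.bits b := List.reverse_injective h
  refine Nat.eq_of_testBit_eq fun i => ?_
  rw [Nat.testBit_eq_inth, Nat.testBit_eq_inth, h']

theorem bin_cons (N : ℕ) (h : N ≠ 0) : ∃ l, bin N = true :: l ∧ l.length = Nat.log 2 N := by
  have hlen : (bin N).length = Nat.log 2 N + 1 := by simp [bin, bits_length N h]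
  cases hb : bin N with
  | nil => simp [hb] at hlen
  | cons b l =>
    refine ⟨l, ?_, by simpa [hb] using hlen⟩
    have hlast : (Nat.bits N).getLast? = some b := by
      have : (Nat.bits N) = (b :: l).reverse := by rw [← hb, bin, List.reverse_reverse]
      rw [this]; simp
    have h2 : N.testBit (Nat.log 2 N) = true := by
      rw [← Nat.log2_eq_log_two]; exact Nat.testBit_log2 h
    rw [Nat.testBit_eq_inth, List.getI_eq_getElem _ (by rw [bits_length N h]; omega)] at h2
    rw [List.getLast?_eq_getElem?, bits_length N h] at hlast
    simp only [Nat.add_sub_cancel] at hlast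
    rw [List.getElem?_eq_getElem (by rw [bits_length N h]; omega), h2] at hlast
    simp at hlast
    rw [← hlast]

theorem exists_bin (l : List Bool) : ∃ N, N ≠ 0 ∧ bin N = true :: l := by
  induction l using List.reverseRecOn with
  | nil => exact ⟨1, by simp, by simp [bin]⟩
  | append_singleton l b ih =>
    obtain ⟨N, hN, h⟩ := ih
    refine ⟨Nat.bit b N, by simp [Nat.bit_eq_zero_iff, hN], ?_⟩
    unfold bin at h ⊢
    rw [Nat.bits_append_bit _ _ (fun h0 => absurd h0 hN)]
    simp [h]

theorem eliasGroups_of_lt {N : ℕ} (h : ¬ 2 ≤ N) : eliasGroups N = [] := by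
  rw [eliasGroups, dif_neg h]

theorem eliasGroups_of_le {N : ℕ} (h : 2 ≤ N) :
    eliasGroups N = eliasGroups (Nat.log 2 N) ++ bin N := by
  rw [eliasGroups, dif_pos h]

/-- If a chain of groups is a prefix of `S` and the next symbol is `1`, the chain extends. -/
theorem eliasGroups_step {N : ℕ} (hN : 1 ≤ N) {S : ℕ → Bool}
    (h : IsPrefixOf (eliasGroups N) S) (h1 : S (eliasGroups N).length = true) :
    ∃ M, 2 ≤ M ∧ Nat.log 2 M = N ∧ IsPrefixOf (eliasGroups M) S := by
  obtain ⟨M, hM0, hM⟩ :=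
    exists_bin ((List.range N).map fun j => S ((eliasGroups N).length + (j + 1)))
  obtain ⟨l, hl, hlen⟩ := bin_cons M hM0
  have hlog : Nat.log 2 M = N := by
    rw [← hlen]
    have := hl.symm.trans hM
    simp only [List.cons.injEq, true_and] at this
    simp [this]
  have hM2 : 2 ≤ M := by
    by_contra hc
    have : Nat.log 2 M = 0 := Nat.log_of_lt (by omega)
    omega
  refine ⟨M, hM2, hlog, ?_⟩
  rw [eliasGroups_of_le hM2, hlog, isPrefixOf_append, hM]
  refine ⟨h, ?_⟩
  intro i hi
  cases i with
  | zero => simpa using h1.symm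
  | succ j => simp

theorem exists_eliasCode (t : ℕ) : ∃ N, 1 ≤ N ∧ IsPrefixOf (eliasCode N) (revBits t) := by
  have key : ∀ d N : ℕ, 1 ≤ N → IsPrefixOf (eliasGroups N) (revBits t) →
      t ≤ (eliasGroups N).length + d → ∃ N, 1 ≤ N ∧ IsPrefixOf (eliasCode N) (revBits t) := by
    intro d
    induction d with
    | zero =>
      intro N hN h hd
      refine ⟨N, hN, (isPrefixOf_append _ _ _).2 ⟨h, (isPrefixOf_singleton _ _).2 ?_⟩⟩
      have : t < 2 ^ (eliasGroups N).length :=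
        lt_of_lt_of_le Nat.lt_two_pow_self (Nat.pow_le_pow_right (by norm_num) hd)
      simp only [revBits, Nat.add_zero]
      exact (Nat.testBit_lt_two_pow this).symm
    | succ d ih =>
      intro N hN h hd
      by_cases hS : revBits t (eliasGroups N).length = true
      · obtain ⟨M, hM2, hlog, hM⟩ := eliasGroups_step hN h hS
        refine ih M (by omega) hM ?_
        obtain ⟨l, hl, -⟩ := bin_cons M (by omega)
        rw [eliasGroups_of_le hM2, hlog, hl]
        simp only [List.length_append, List.length_cons]
        omega
      · refine ⟨N, hN, (isPrefixOf_append _ _ _).2 ⟨h, (isPrefixOf_singleton _ _).2 ?_⟩⟩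
        simpa using hS
  refine key t 1 le_rfl ?_ (by omega)
  rw [eliasGroups_of_lt (by norm_num)]
  intro i hi
  simp at hi

/-- The omega-code is prefix-free. -/
theorem eliasCode_unique {S : ℕ → Bool} {M N : ℕ} (hM : 1 ≤ M) (hN : 1 ≤ N)
    (h : IsPrefixOf (eliasCode M) S) (h' : IsPrefixOf (eliasCode N) S) : M = N := by
  have key : ∀ N : ℕ, 1 ≤ N → IsPrefixOf (eliasCode N) S → ∀ M : ℕ, 1 ≤ M →
      IsPrefixOf (eliasGroups M) S → ∃ j, (Nat.log 2)^[j] N = M := by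
    intro N hN hcode
    obtain ⟨hg, hz⟩ := (isPrefixOf_append _ _ _).1 hcode
    rw [isPrefixOf_singleton] at hz
    have chain : ∀ j, 1 ≤ (Nat.log 2)^[j] N → IsPrefixOf (eliasGroups ((Nat.log 2)^[j] N)) S := by
      intro j
      induction j with
      | zero => intro _; exact hg
      | succ j ih =>
        intro h1
        rw [Function.iterate_succ_apply'] at h1 ⊢
        have h2 : 2 ≤ (Nat.log 2)^[j] N := by
          by_contra hc
          rw [Nat.log_of_lt (by omega)] at h1
          omega
        have h3 := ih (by omega)
        rw [eliasGroups_of_le h2, isPrefixOf_append] at h3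
        exact h3.1
    intro M
    induction M using Nat.strong_induction_on with
    | _ M ih =>
      intro hM1 hMg
      by_cases hM2 : 2 ≤ M
      · have hMg' := hMg
        rw [eliasGroups_of_le hM2, isPrefixOf_append] at hMg'
        obtain ⟨hA, hB⟩ := hMg'
        obtain ⟨j, hj⟩ := ih (Nat.log 2 M) (Nat.log_lt_self 2 (by omega))
          (Nat.log_pos (by norm_num) hM2) hA
        obtain ⟨l, hl, hlen⟩ := bin_cons M (by omega)
        cases j with
        | zero =>
          simp only [Function.iterate_zero, id] at hj
          have := hB 0 (by simp [hl])
          simp only [hl, List.getElem_cons_zero, ← hj] at this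
          rw [← this] at hz
          simp at hz
        | succ j =>
          refine ⟨j, ?_⟩
          rw [Function.iterate_succ_apply'] at hj
          set K := (Nat.log 2)^[j] N with hK
          have hpos : 1 ≤ Nat.log 2 M := Nat.log_pos (by norm_num) hM2
          have hK2 : 2 ≤ K := by
            by_contra hc
            rw [Nat.log_of_lt (by omega)] at hj
            omega
          have hC := chain j (by omega)
          rw [← hK, eliasGroups_of_le hK2, isPrefixOf_append, hj] at hC
          refine bin_injective (List.ext_getElem ?_ fun i h1 h2 => ?_)
          · simp [bin, bits_length K (by omega), bits_length M (by omega), hj]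
          · rw [hC.2 i h1, hB i h2]
      · obtain rfl : M = 1 := by omega
        clear ih hMg hcode hg hz chain
        induction N using Nat.strong_induction_on with
        | _ N ihN =>
          by_cases hN2 : 2 ≤ N
          · obtain ⟨j, hj⟩ := ihN (Nat.log 2 N) (Nat.log_lt_self 2 (by omega))
              (Nat.log_pos (by norm_num) hN2)
            exact ⟨j + 1, by rwa [Function.iterate_succ_apply]⟩
          · exact ⟨0, by simp; omega⟩
  have le_iter : ∀ j K : ℕ, (Nat.log 2)^[j] K ≤ K := by
    intro j K
    induction j with
    | zero => exact le_rfl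
    | succ j ih =>
      rw [Function.iterate_succ_apply']
      exact (Nat.log_le_self 2 _).trans ih
  obtain ⟨i, hi⟩ := key N hN h' M hM ((isPrefixOf_append _ _ _).1 h).1
  obtain ⟨j, hj⟩ := key M hM h N hN ((isPrefixOf_append _ _ _).1 h').1
  exact le_antisymm (hi ▸ le_iter i N) (hj ▸ le_iter j M)

/-- `a(t)`: the positive integer whose omega-code is a prefix of the reversed and padded binary
representation of `t`.  It exists by `exists_eliasCode` and is unique by `eliasCode_unique`. -/
noncomputable def elias (t : ℕ) : ℕ := (exists_eliasCode t).choose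

/-- `a'(t) = (-1)^(a(t) mod 2) ⌊a(t)/2⌋`. -/
noncomputable def elias' (t : ℕ) : ℤ := (-1) ^ (elias t % 2) * ((elias t / 2 : ℕ) : ℤ)

/-! ### The function `ζ` -/

/-- `log^{(i)} x`, the `i`-fold iterated binary logarithm. -/
noncomputable def iterLog (i : ℕ) (x : ℝ) : ℝ := (Real.logb 2)^[i] x

/-- `log^* x`, the least `i` with `log^{(i)} x < 2`. For `x ≥ 1` this is the number of times that
the binary logarithm can be applied with all the values staying at least `1`, so that
`1 ≤ log^{(log^* x)} x < 2`. -/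
noncomputable def logStar (x : ℝ) : ℕ := sInf {i | iterLog i x < 2}

/-- `ζ(x) = (2x)(2 log x)(2 log^{(2)} x) ⋯ (2 log^{(log^* x)} x)`. -/
noncomputable def zeta (x : ℝ) : ℝ := ∏ i ∈ Finset.range (logStar x + 1), 2 * iterLog i x

/-! ### Protocols in the GlobalClock model -/

/-- An acknowledgment-based protocol in the GlobalClock model: for each global wake-up time `s`, a
probability law on infinite binary strings. The bit with index `i` of the string of a party that
wakes up at time `s` says whether the party grabs the resource at local time `i + 1`, that is, at
global time `s + i + 1`, provided that it has not been successful before. -/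
structure Protocol where
  law : ℕ → Measure (ℕ → Bool)
  isProbabilityMeasure_law : ∀ s, IsProbabilityMeasure (law s)

instance (D : Protocol) (s : ℕ) : IsProbabilityMeasure (D.law s) := D.isProbabilityMeasure_law s

/-- A protocol is memoryless if the decision at each local time is independent of the decisions at
the other local times. -/
def Protocol.Memoryless (D : Protocol) : Prop :=
  ∀ s, iIndepFun (fun (i : ℕ) (x : ℕ → Bool) => x i) (D.law s)

/-- The probability that a party woken up at time `s` has a `1` in its string at global time
`t > s`. -/
noncomputable def Protocol.grabProb (D : Protocol) (t s : ℕ) : ℝ :=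
  (D.law s).real {x | x (t - s - 1) = true}

/-- The random strings: `ω (u, s)` is the string that party `u` uses if it is woken up at time
`s`. -/
abbrev Strings (n : ℕ) : Type := Fin n × ℕ → ℕ → Bool

/-- All strings are drawn independently, `ω (u, s)` from the law `D.law s`. A party uses only the
string that belongs to its actual wake-up time. -/
noncomputable def Protocol.prob (D : Protocol) (n : ℕ) : Measure (Strings n) :=
  Measure.infinitePi fun k : Fin n × ℕ => D.law k.2

/-! ### Executions against an adaptive adversary -/

/-- What is recorded about one time slot: the set of parties woken up in the slot, and the set of
awake parties whose string has a `1` in the slot. -/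
abbrev Slot (n : ℕ) : Type := Finset (Fin n) × Finset (Fin n)

/-- An adaptive adversary with at most `n` parties decides in each slot `t`, as a function of the
complete history of the slots `0, …, t - 1` (the most recent slot first), which parties to wake up.
Requests to wake up a party that is already awake have no effect. -/
abbrev Adversary (n : ℕ) : Type := List (Slot n) → Finset (Fin n)

/-- The situation just before a time slot: the wake-up time of each party (`none` if it has not been
woken up), the time of its first success (`none` if it has had none), and the history. -/
structure Config (n : ℕ) where
  wakeTime : Fin n → Option ℕ
  succTime : Fin n → Option ℕ
  history : List (Slot n)

/-- The time slot `t`. The adversary wakes up parties; every party woken up before `t` with a `1` in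
its string that has not been successful grabs the resource; if exactly one party grabs, it is
successful. -/
def step {n : ℕ} (A : Adversary n) (ω : Strings n) (t : ℕ) (c : Config n) : Config n :=
  let woken : Finset (Fin n) := {u ∈ A c.history | c.wakeTime u = none}
  let ones : Finset (Fin n) :=
    {u | ((c.wakeTime u).any fun s => ω (u, s) (t - s - 1)) = true}
  let grab : Finset (Fin n) := {u ∈ ones | c.succTime u = none}
  { wakeTime := fun u => if u ∈ woken then some t else c.wakeTime u
    succTime := fun u => if grab = {u} then some t else c.succTime u
    history := (woken, ones) :: c.history }

/-- The configuration just before slot `t`. -/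
def config {n : ℕ} (A : Adversary n) (ω : Strings n) : ℕ → Config n
  | 0 => ⟨fun _ => none, fun _ => none, []⟩
  | t + 1 => step A ω t (config A ω t)

/-- Party `u` is woken up in slot `s`. -/
def WakesAt {n : ℕ} (A : Adversary n) (ω : Strings n) (u : Fin n) (s : ℕ) : Prop :=
  (config A ω (s + 1)).wakeTime u = some s

/-- Party `u` achieves its success in slot `t`. -/
def SucceedsAt {n : ℕ} (A : Adversary n) (ω : Strings n) (u : Fin n) (t : ℕ) : Prop :=
  (config A ω (t + 1)).succTime u = some t

/-- The latency of `u`, the time from its wake-up to its success, is at most `L`. (There is no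
requirement if the adversary never wakes up `u`.) -/
def LatencyLE {n : ℕ} (A : Adversary n) (ω : Strings n) (u : Fin n) (L : ℝ) : Prop :=
  ∀ s, WakesAt A ω u s → ∃ t, SucceedsAt A ω u t ∧ (t : ℝ) - s ≤ L

/-- Against every adaptive adversary with at most `n` parties, each party has latency at most `L`
with probability at least `1 - q`. -/
def Protocol.HasLatency (D : Protocol) (n : ℕ) (L q : ℝ) : Prop :=
  ∀ (A : Adversary n) (u : Fin n), 1 - q ≤ (D.prob n).real {ω | LatencyLE A ω u L}

end ContentionResolution

/-! Fix a party `u` and cut the time after its wake-up into `J = 2053 n` windows of length `P ≤ ζ(4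
log log n)`. The omega-code of `N ≤ x` has at most `log₂ ζ(x)` symbols, and having a given prefix of
length `m` is a congruence condition modulo `2 ^ m`. Hence every window contains each value of `a'`
of modulus at most `K ≈ 2 log log n` (`exists_period`).

At most `3 n` windows fail to be quiet (`card_not_quiet_le`). In a quiet window the set of active
parties is frozen and ages change by a factor of at most 2. Let `H` be the sum of the inverse ages
at its start. The contention in slot `t` is at most `2 ^ a'(t) * H`, and at least a quarter of this
when this product is at most 2. There are three cases.

If `H > 2 ^ K`, the window is one of at most `n`: each party contributes at most a harmonic sum `2 +
ln J ≤ 2 ^ K` to the total of `H` over all windows (`card_high_load_le`).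

If `2 ^ (-K) ≤ H ≤ 2 ^ K`, a slot with `a'(t) = -⌊log H⌋` has contention of constant order, so
somebody succeeds with constant probability. As there are at most `n` successes, `2048 n` such slots
occur only with exponentially small probability (`prob_moderate_le`).

If `H < 2 ^ (-K)`, a slot with `a'(t) = K` has contention at most 1, and `u` grabs with probability
at least `p` of order `log² n / (n ζ)`. Surviving `n` such slots has probability `exp(-Ω(log² n /
ζ)) ≤ n ^ (-c)`, because `ζ(4 log log n) = o(log n)` (`prob_favorable_le`).

The adversary is adaptive, so both probability bounds come from an exponential supermartingale
(`measure_exists_le_hits`). It applies because memorylessness makes the bits of a slot independent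
of all earlier slots (`mul_measure_le_of_step`). The asymptotics of `ζ` follow by bootstrapping
`ζ(x) = 2x ζ(log x)`. -/

namespace ContentionResolution

/-! ### A concentration inequality for adapted events -/

section Concentration

variable {Ω : Type*}

open Classical in
/-- The number of `t < T` with `ω ∈ B t`. -/
noncomputable def hits (B : ℕ → Set Ω) (ω : Ω) (T : ℕ) : ℕ :=
  ((Finset.range T).filter fun t => ω ∈ B t).card

theorem hits_zero (B : ℕ → Set Ω) (ω : Ω) : hits B ω 0 = 0 := by simp [hits]

open Classical in
theorem hits_succ (B : ℕ → Set Ω) (ω : Ω) (T : ℕ) :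
    hits B ω (T + 1) = hits B ω T + if ω ∈ B T then 1 else 0 := by
  unfold hits
  rw [Finset.range_add_one, Finset.filter_insert]
  split_ifs with h
  · rw [Finset.card_insert_of_notMem (by simp)]
  · rfl

theorem hits_mono (B : ℕ → Set Ω) (ω : Ω) : Monotone (hits B ω) := by
  refine monotone_nat_of_le_succ fun T => ?_
  rw [hits_succ]; omega

/-- Choosing a witness for each index gives an injection. Working with a relation avoids naming the
witness map, for instance "the party that is successful in slot `t`". -/
theorem card_le_card_of_unique {ι α : Type*} [Fintype α] {S : Finset ι} (R : α → ι → Prop)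
    (h : ∀ i ∈ S, ∃ a, R a i) (huniq : ∀ a i j, R a i → R a j → i = j) :
    S.card ≤ Fintype.card α := by
  have h' : ∀ i : S, ∃ a, R a i := fun i => h i i.2
  choose f hf using h'
  rw [← Fintype.card_coe]
  refine Fintype.card_le_of_injective f fun i j hij => Subtype.ext ?_
  have h2 := hf j
  rw [← hij] at h2
  exact huniq _ _ _ (hf i) h2

theorem hits_le_card {α : Type*} [Fintype α] {B : ℕ → Set Ω} {ω : Ω} (R : α → ℕ → Prop)
    (h : ∀ t, ω ∈ B t → ∃ a, R a t) (huniq : ∀ a t t', R a t → R a t' → t = t') (T : ℕ) :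
    hits B ω T ≤ Fintype.card α := by
  classical
  exact card_le_card_of_unique R (fun t ht => h t (Finset.mem_filter.1 ht).2) huniq

theorem card_le_hits {ι : Type*} {S : Finset ι} {B : ℕ → Set Ω} {ω : Ω} {T : ℕ} (R : ℕ → ι → Prop)
    (h : ∀ i ∈ S, ∃ t < T, R t i ∧ ω ∈ B t) (huniq : ∀ t i j, R t i → R t j → i = j) :
    S.card ≤ hits B ω T := by
  classical
  refine (card_le_card_of_unique
    (fun (t : ↥((Finset.range T).filter fun t => ω ∈ B t)) i => R t.1 i) (fun i hi => ?_)
    fun t => huniq t.1).trans (by rw [Fintype.card_coe, hits])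
  obtain ⟨t, ht, hR, hB⟩ := h i hi
  exact ⟨⟨t, Finset.mem_filter.2 ⟨Finset.mem_range.2 ht, hB⟩⟩, hR⟩

/-- The exponential process `exp (q / 2 * #B - #(B ∩ Z))`. -/
noncomputable def expWeight (B Z : ℕ → Set Ω) (q : ℝ) (T : ℕ) (ω : Ω) : ENNReal :=
  ENNReal.ofReal (Real.exp (q / 2 * hits B ω T - hits (fun t => B t ∩ Z t) ω T))

theorem measurable_hits {m : MeasurableSpace Ω} {B : ℕ → Set Ω} {T : ℕ}
    (hB : ∀ t < T, MeasurableSet (B t)) : Measurable (fun ω => hits B ω T) := by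
  classical
  induction T with
  | zero => simp only [hits_zero]; exact measurable_const
  | succ T ih =>
    simp only [hits_succ]
    exact (ih fun t ht => hB t (by omega)).add
      (Measurable.ite (hB T (by omega)) measurable_const measurable_const)

theorem measurable_expWeight {m : MeasurableSpace Ω} {B Z : ℕ → Set Ω} {T : ℕ}
    (hB : ∀ t < T, MeasurableSet (B t)) (hZ : ∀ t < T, MeasurableSet (Z t)) (q : ℝ) :
    Measurable (expWeight B Z q T) := by
  have h1 := measurable_hits hB
  have h2 := measurable_hits (B := fun t => B t ∩ Z t) fun t ht => (hB t ht).inter (hZ t ht)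
  have h1' : Measurable fun ω => (hits B ω T : ℝ) := measurable_from_nat.comp h1
  have h2' : Measurable fun ω => (hits (fun t => B t ∩ Z t) ω T : ℝ) := measurable_from_nat.comp h2
  exact ((h1'.const_mul _).sub h2').exp.ennreal_ofReal

variable [m0 : MeasurableSpace Ω] {μ : Measure Ω}

theorem measurable_expWeight_filtration {F : Filtration ℕ m0} {B Z : ℕ → Set Ω}
    (hB : ∀ t, MeasurableSet[F t] (B t)) (hZ : ∀ t, MeasurableSet[F (t + 1)] (Z t)) (q : ℝ) (T : ℕ) :
    Measurable[F T] (expWeight B Z q T) :=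
  measurable_expWeight (m := F T) (fun t ht => F.mono ht.le _ (hB t))
    (fun t ht => F.mono ht _ (hZ t)) q

/-- The hypothesis says that the conditional probability of `Z` given `m` is at least `q` on `B`,
phrased with sets only. It is an inequality between measures on `m`, and so it passes to integrals
of `m`-measurable functions. -/
theorem mul_setLIntegral_le {m : MeasurableSpace Ω} (hm : m ≤ m0) {B Z : Set Ω}
    (hB : MeasurableSet[m] B) {q : ENNReal}
    (h : ∀ E, MeasurableSet[m] E → E ⊆ B → q * μ E ≤ μ (E ∩ Z))
    {f : Ω → ENNReal} (hf : Measurable[m] f) :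
    q * ∫⁻ ω in B, f ω ∂μ ≤ ∫⁻ ω in B ∩ Z, f ω ∂μ := by
  have hle : (q • μ.restrict B).trim hm ≤ (μ.restrict (B ∩ Z)).trim hm := by
    refine Measure.le_iff.2 fun E hE => ?_
    rw [trim_measurableSet_eq hm hE, trim_measurableSet_eq hm hE, Measure.smul_apply,
      Measure.restrict_apply (hm _ hE), Measure.restrict_apply (hm _ hE), smul_eq_mul,
      ← Set.inter_assoc]
    exact h _ (@MeasurableSet.inter _ m _ _ hE hB) Set.inter_subset_right
  calc q * ∫⁻ ω in B, f ω ∂μ = ∫⁻ ω, f ω ∂(q • μ.restrict B) := by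
        rw [lintegral_smul_measure, smul_eq_mul]
    _ = ∫⁻ ω, f ω ∂((q • μ.restrict B).trim hm) := (lintegral_trim hm hf).symm
    _ ≤ ∫⁻ ω, f ω ∂((μ.restrict (B ∩ Z)).trim hm) := lintegral_mono' hle le_rfl
    _ = _ := lintegral_trim hm hf

/-- This calibrates the weights of `expWeight`: since `exp (-1) ≤ 1 / 2`, the second factor is at
most `1 - q / 2 ≤ exp (-q / 2)`. -/
theorem exp_half_mul_le_one {q : ℝ} (h0 : 0 ≤ q) :
    Real.exp (q / 2) * (1 - q * (1 - Real.exp (-1))) ≤ 1 := by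
  have h1 : Real.exp (-1) ≤ 1 / 2 := by
    rw [Real.exp_neg, inv_le_comm₀ (Real.exp_pos 1) (by norm_num)]
    have := Real.add_one_le_exp (1 : ℝ)
    norm_num at this ⊢
    linarith
  have h2 : 1 - q * (1 - Real.exp (-1)) ≤ Real.exp (-(q / 2)) := by
    have := Real.add_one_le_exp (-(q / 2))
    nlinarith
  calc _ ≤ Real.exp (q / 2) * Real.exp (-(q / 2)) := by gcongr
    _ = 1 := by rw [← Real.exp_add]; simp

/-- Supermartingale argument: a step changes the weight only on `B T`, by `exp (q / 2 - 1)` on `Z T`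
and by `exp (q / 2)` off it. The conditional mean of this factor is at most `exp (q / 2) * (1 - q *
(1 - exp (-1))) ≤ 1`. -/
theorem lintegral_expWeight_le [IsProbabilityMeasure μ] {F : Filtration ℕ m0} {B Z : ℕ → Set Ω}
    (hB : ∀ t, MeasurableSet[F t] (B t)) (hZ : ∀ t, MeasurableSet[F (t + 1)] (Z t)) {q : ℝ}
    (h0 : 0 ≤ q)
    (h : ∀ t E, MeasurableSet[F t] E → E ⊆ B t → ENNReal.ofReal q * μ E ≤ μ (E ∩ Z t)) (T : ℕ) :
    ∫⁻ ω, expWeight B Z q T ω ∂μ ≤ 1 := by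
  classical
  induction T with
  | zero => simp [expWeight, hits_zero]
  | succ T ih =>
    set W := expWeight B Z q T with hW
    have hBm : MeasurableSet (B T) := F.le T _ (hB T)
    have hZm : MeasurableSet (Z T) := F.le (T + 1) _ (hZ T)
    have hWm : Measurable W := (measurable_expWeight_filtration hB hZ q T).mono (F.le T) le_rfl
    have key := mul_setLIntegral_le (F.le T) (hB T) (h T)
      (measurable_expWeight_filtration hB hZ q T)
    rw [← hW] at key
    have e0 : ∫⁻ ω in (B T)ᶜ, expWeight B Z q (T + 1) ω ∂μ = ∫⁻ ω in (B T)ᶜ, W ω ∂μ := by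
      refine setLIntegral_congr_fun hBm.compl fun ω hω => ?_
      have hω' : ω ∉ B T := hω
      simp [hW, expWeight, hits_succ, hω']
    have e1 : ∫⁻ ω in B T ∩ Z T, expWeight B Z q (T + 1) ω ∂μ =
        ENNReal.ofReal (Real.exp (q / 2) * Real.exp (-1)) * ∫⁻ ω in B T ∩ Z T, W ω ∂μ := by
      rw [← lintegral_const_mul _ hWm]
      refine setLIntegral_congr_fun (hBm.inter hZm) fun ω hω => ?_
      obtain ⟨h1, h2⟩ := hω
      simp only [hW, expWeight, hits_succ, h1, h2, Set.mem_inter_iff, and_self, if_true]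
      rw [← ENNReal.ofReal_mul (by positivity), ← Real.exp_add, ← Real.exp_add]
      congr 2; push_cast; ring
    have e2 : ∫⁻ ω in B T \ Z T, expWeight B Z q (T + 1) ω ∂μ =
        ENNReal.ofReal (Real.exp (q / 2)) * ∫⁻ ω in B T \ Z T, W ω ∂μ := by
      rw [← lintegral_const_mul _ hWm]
      refine setLIntegral_congr_fun (hBm.diff hZm) fun ω hω => ?_
      obtain ⟨h1, h2⟩ := hω
      simp only [hW, expWeight, hits_succ, h1, h2, Set.mem_inter_iff, and_false, if_true, if_false]
      rw [← ENNReal.ofReal_mul (by positivity), ← Real.exp_add]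
      congr 2; push_cast; ring
    have s1 := lintegral_inter_add_sdiff (μ := μ) W (B T) hZm
    have s2 := lintegral_inter_add_sdiff (μ := μ) (expWeight B Z q (T + 1)) (B T) hZm
    have s3 := lintegral_add_compl (μ := μ) W hBm
    rw [← lintegral_add_compl _ hBm, ← s2, e0, e1, e2]
    rw [← s3, ← s1] at ih
    rw [← s1] at key
    set I := ∫⁻ ω in B T ∩ Z T, W ω ∂μ with hI
    set J := ∫⁻ ω in B T \ Z T, W ω ∂μ with hJ
    set R := ∫⁻ ω in (B T)ᶜ, W ω ∂μ with hR
    -- All three integrals are finite by the induction hypothesis, so the remaining inequality can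
    -- be checked over the reals.
    have hI' : I ≠ ⊤ := fun hc => by simp [hc] at ih
    have hJ' : J ≠ ⊤ := fun hc => by simp [hc] at ih
    have hR' : R ≠ ⊤ := fun hc => by simp [hc] at ih
    lift I to NNReal using hI' with i hi
    lift J to NNReal using hJ' with j hj
    lift R to NNReal using hR' with r hr
    refine le_trans ?_ ih
    gcongr ?_ + _
    rw [ENNReal.ofReal, ← ENNReal.coe_add, ← ENNReal.coe_mul, ENNReal.coe_le_coe] at key
    rw [ENNReal.ofReal, ENNReal.ofReal, ← ENNReal.coe_mul, ← ENNReal.coe_mul, ← ENNReal.coe_add,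
      ← ENNReal.coe_add, ENNReal.coe_le_coe]
    rw [← NNReal.coe_le_coe] at key ⊢
    push_cast at key ⊢
    rw [Real.coe_toNNReal _ h0] at key
    rw [Real.coe_toNNReal _ (by positivity), Real.coe_toNNReal _ (by positivity)]
    have hq := exp_half_mul_le_one h0
    have he : Real.exp (-1) ≤ 1 := by simp
    have hij : (0 : ℝ) ≤ i + j := by positivity
    have hb := Real.exp_pos (q / 2)
    have t1 := mul_le_mul_of_nonneg_right hq hij
    have t2 := mul_le_mul_of_nonneg_left key (mul_nonneg hb.le (sub_nonneg.2 he))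
    nlinarith

/-- If, conditionally on the past, `Z t` has probability at least `q` whenever `B t` happens, and
`B t ∩ Z t` happens at most `k` times, then `B t` is unlikely to happen often. -/
theorem measure_exists_le_hits [IsProbabilityMeasure μ] {F : Filtration ℕ m0} {B Z : ℕ → Set Ω}
    (hB : ∀ t, MeasurableSet[F t] (B t)) (hZ : ∀ t, MeasurableSet[F (t + 1)] (Z t)) {q : ℝ}
    (h0 : 0 ≤ q)
    (h : ∀ t E, MeasurableSet[F t] E → E ⊆ B t → ENNReal.ofReal q * μ E ≤ μ (E ∩ Z t))
    {k : ℕ} (hk : ∀ ω T, hits (fun t => B t ∩ Z t) ω T ≤ k) (M : ℕ) :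
    μ {ω | ∃ T, M ≤ hits B ω T} ≤ ENNReal.ofReal (Real.exp (k - q / 2 * M)) := by
  -- The events increase with the horizon, so continuity from below reduces the claim to a fixed
  -- `T`, where Markov's inequality for `expWeight` applies.
  have hmono : Monotone fun T => {ω | M ≤ hits B ω T} :=
    fun T T' hT ω hω => le_trans (show M ≤ hits B ω T from hω) (hits_mono B ω hT)
  have hset : {ω | ∃ T, M ≤ hits B ω T} = ⋃ T, {ω | M ≤ hits B ω T} := by ext; simp
  rw [hset, hmono.measure_iUnion]
  refine iSup_le fun T => ?_
  have hWm : Measurable (expWeight B Z q T) :=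
    (measurable_expWeight_filtration hB hZ q T).mono (F.le T) le_rfl
  have hsub : {ω | M ≤ hits B ω T} ⊆
      {ω | ENNReal.ofReal (Real.exp (q / 2 * M - k)) ≤ expWeight B Z q T ω} := by
    intro ω hω
    have h1 : (M : ℝ) ≤ hits B ω T := by exact_mod_cast hω
    have h2 : (hits (fun t => B t ∩ Z t) ω T : ℝ) ≤ k := by exact_mod_cast hk ω T
    simp only [expWeight, Set.mem_ofPred_eq]
    gcongr
  have hmk := mul_meas_ge_le_lintegral (μ := μ) hWm (ENNReal.ofReal (Real.exp (q / 2 * M - k)))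
  have := (mul_le_mul_right (measure_mono (μ := μ) hsub)
    (ENNReal.ofReal (Real.exp (q / 2 * M - k)))).trans
    (hmk.trans (lintegral_expWeight_le hB hZ h0 h T))
  calc μ {ω | M ≤ hits B ω T}
      = ENNReal.ofReal (Real.exp (k - q / 2 * M)) *
        (ENNReal.ofReal (Real.exp (q / 2 * M - k)) * μ {ω | M ≤ hits B ω T}) := by
        rw [← mul_assoc, ← ENNReal.ofReal_mul (by positivity), ← Real.exp_add]; simp
    _ ≤ ENNReal.ofReal (Real.exp (k - q / 2 * M)) * 1 := by gcongr
    _ = _ := mul_one _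

end Concentration

/-! ### Independence of the bits -/

section Bits

variable {n : ℕ} {D : Protocol}

instance (D : Protocol) (n : ℕ) : IsProbabilityMeasure (D.prob n) := by
  unfold Protocol.prob; infer_instance

/-- The bit with index `k = ((u, s), i)`: the bit `i` of the string of `u` for wake-up time `s`. -/
def bitVar (k : (Fin n × ℕ) × ℕ) (ω : Strings n) : Bool := ω k.1 k.2

/-- The slot in which a bit may be used. -/
def bitSlot (k : (Fin n × ℕ) × ℕ) : ℕ := k.1.2 + k.2 + 1

theorem measurable_bitVar (k : (Fin n × ℕ) × ℕ) : Measurable (bitVar k) := by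
  unfold bitVar; fun_prop

theorem measurePreserving_string (D : Protocol) (k : Fin n × ℕ) :
    MeasurePreserving (fun ω : Strings n => ω k) (D.prob n) (D.law k.2) :=
  measurePreserving_eval_infinitePi (fun k : Fin n × ℕ => D.law k.2) k

/-- Different strings are independent by the product construction, and the bits within one string
are independent by memorylessness. -/
theorem iIndepFun_bitVar (hD : D.Memoryless) :
    iIndepFun (bitVar (n := n)) (D.prob n) := by
  refine iIndepFun_uncurry' (X := fun (k : Fin n × ℕ) (i : ℕ) (ω : Strings n) => ω k i)
    (fun k i => by fun_prop) ?_ fun k => ?_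
  · exact iIndepFun_infinitePi (X := fun (_ : Fin n × ℕ) x => x) fun _ => measurable_id
  · rw [iIndepFun_iff_measure_inter_preimage_eq_mul]
    intro S sets hS
    have hmp := measurePreserving_string D k
    have h1 := (hD k.2).measure_inter_preimage_eq_mul S (sets := sets) hS
    have h2 : ∀ i ∈ S, MeasurableSet ((fun x : ℕ → Bool => x i) ⁻¹' sets i) :=
      fun i hi => (measurable_pi_apply i) (hS i hi)
    rw [← hmp.measure_preimage (Finset.measurableSet_biInter S h2).nullMeasurableSet] at h1
    rw [show (⋂ i ∈ S, (fun ω : Strings n => ω k i) ⁻¹' sets i) =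
      (fun ω : Strings n => ω k) ⁻¹' ⋂ i ∈ S, (fun x : ℕ → Bool => x i) ⁻¹' sets i by
        simp [Set.preimage_iInter, Set.preimage_preimage], h1]
    refine Finset.prod_congr rfl fun i hi => ?_
    rw [← hmp.measure_preimage (h2 i hi).nullMeasurableSet]
    rfl

/-- The information contained in the bits of the slots in `S`. -/
@[reducible] def bitAlgebra (n : ℕ) (S : Set ℕ) : MeasurableSpace (Strings n) :=
  ⨆ k ∈ {k : (Fin n × ℕ) × ℕ | bitSlot k ∈ S}, MeasurableSpace.comap (bitVar k) ⊤

theorem bitAlgebra_le (S : Set ℕ) : bitAlgebra n S ≤ MeasurableSpace.pi :=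
  iSup₂_le fun k _ => (measurable_bitVar k).comap_le

theorem bitAlgebra_mono {S T : Set ℕ} (h : S ⊆ T) : bitAlgebra n S ≤ bitAlgebra n T :=
  biSup_mono fun _ hk => h hk

theorem measurable_bitVar_bitAlgebra {S : Set ℕ} {k : (Fin n × ℕ) × ℕ} (hk : bitSlot k ∈ S) :
    Measurable[bitAlgebra n S] (bitVar k) := by
  have h : MeasurableSpace.comap (bitVar k) ⊤ ≤ bitAlgebra n S :=
    le_iSup₂_of_le (f := fun (k : (Fin n × ℕ) × ℕ) (_ : k ∈ {k | bitSlot k ∈ S}) =>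
      MeasurableSpace.comap (bitVar k) ⊤) k hk le_rfl
  exact Measurable.of_comap_le h

theorem indep_bitAlgebra (hD : D.Memoryless) {S T : Set ℕ} (h : Disjoint S T) :
    Indep (bitAlgebra n S) (bitAlgebra n T) (D.prob n) := by
  refine indep_iSup_of_disjoint (fun k => (measurable_bitVar k).comap_le)
    (iIndepFun_bitVar hD).iIndep ?_
  rw [Set.disjoint_left] at h ⊢
  exact fun k hk hk' => h hk hk'

/-- The information contained in the bits of the slots before `t`. -/
def pastFiltration (n : ℕ) : Filtration ℕ (MeasurableSpace.pi : MeasurableSpace (Strings n)) where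
  seq t := bitAlgebra n (Set.Iio t)
  mono' _ _ h := bitAlgebra_mono (Set.Iio_subset_Iio h)
  le' _ := bitAlgebra_le _

theorem prob_bitVar_true (k : (Fin n × ℕ) × ℕ) :
    (D.prob n) {ω | bitVar k ω = true} = ENNReal.ofReal (D.grabProb (bitSlot k) k.1.2) := by
  have hm : MeasurableSet {x : ℕ → Bool | x k.2 = true} :=
    measurableSet_eq_fun (measurable_pi_apply k.2) measurable_const
  have := (measurePreserving_string D k.1).measure_preimage hm.nullMeasurableSet
  rw [Protocol.grabProb, measureReal_def, ENNReal.ofReal_toReal (measure_ne_top _ _)]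
  have e : bitSlot k - k.1.2 - 1 = k.2 := by unfold bitSlot; omega
  rw [e, ← this]
  rfl

theorem grabProb_nonneg (t s : ℕ) : 0 ≤ D.grabProb t s := measureReal_nonneg

theorem prob_bitVar_false (k : (Fin n × ℕ) × ℕ) :
    (D.prob n) {ω | bitVar k ω = false} = ENNReal.ofReal (1 - D.grabProb (bitSlot k) k.1.2) := by
  have hm : MeasurableSet {ω : Strings n | bitVar k ω = true} :=
    measurable_bitVar k (measurableSet_singleton true)
  have : {ω : Strings n | bitVar k ω = false} = {ω | bitVar k ω = true}ᶜ := by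
    ext; simp
  rw [this, prob_compl_eq_one_sub hm, prob_bitVar_true, ENNReal.ofReal_sub _ (grabProb_nonneg _ _)]
  simp

end Bits

/-! ### Executions -/

section Execution

variable {n : ℕ} {A : Adversary n} {ω : Strings n}

instance : Countable (Config n) :=
  Function.Injective.countable (f := fun c : Config n => (c.wakeTime, c.succTime, c.history))
    fun c d h => by cases c; cases d; simpa using h

/-- Configurations are countable, so the discrete σ-algebra makes every set of them measurable and
allows conditioning on the exact configuration. -/
instance : MeasurableSpace (Config n) := ⊤

instance : DiscreteMeasurableSpace (Config n) := ⟨fun _ => trivial⟩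

theorem wakeTime_succ (t : ℕ) (u : Fin n) :
    (config A ω (t + 1)).wakeTime u =
      if u ∈ A (config A ω t).history ∧ (config A ω t).wakeTime u = none then some t
      else (config A ω t).wakeTime u := by
  simp [config, step]

theorem wakeTime_lt {t : ℕ} {u : Fin n} {s : ℕ} (h : (config A ω t).wakeTime u = some s) :
    s < t := by
  induction t with
  | zero => simp [config] at h
  | succ t ih =>
    rw [wakeTime_succ] at h
    split_ifs at h with hc
    · simp at h; omega
    · have := ih h; omega

theorem wakeTime_mono {t t' : ℕ} (htt : t ≤ t') {u : Fin n} {s : ℕ}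
    (h : (config A ω t).wakeTime u = some s) : (config A ω t').wakeTime u = some s := by
  induction htt with
  | refl => exact h
  | step _ ih =>
    rw [wakeTime_succ, if_neg (by simp [ih]), ih]

theorem wakeTime_eq_of_lt {t t' : ℕ} {u : Fin n} {s : ℕ}
    (h : (config A ω t').wakeTime u = some s) (hs : s < t) :
    (config A ω t).wakeTime u = some s := by
  have key : (config A ω (s + 1)).wakeTime u = some s := by
    clear hs
    induction t' with
    | zero => simp [config] at h
    | succ t' ih =>
      have h' := h
      rw [wakeTime_succ] at h'
      split_ifs at h' with hc
      · obtain rfl : t' = s := by simpa using h'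
        exact h
      · exact ih h'
  exact wakeTime_mono hs key

/-- The parties that are awake and have not been successful. -/
def Config.active (c : Config n) : Finset (Fin n) :=
  {u | c.wakeTime u ≠ none ∧ c.succTime u = none}

theorem Config.mem_active {c : Config n} {u : Fin n} :
    u ∈ c.active ↔ c.wakeTime u ≠ none ∧ c.succTime u = none := by simp [Config.active]

/-- The wake-up time of a party (or `0` if it has not been woken up). -/
def Config.wake (c : Config n) (u : Fin n) : ℕ := (c.wakeTime u).getD 0

/-- The parties that grab the resource in slot `t`. -/
def grabbers (c : Config n) (ω : Strings n) (t : ℕ) : Finset (Fin n) :=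
  {u ∈ c.active | ω (u, c.wake u) (t - c.wake u - 1) = true}

theorem mem_grabbers {c : Config n} {t : ℕ} {u : Fin n} :
    u ∈ grabbers c ω t ↔ u ∈ c.active ∧ ω (u, c.wake u) (t - c.wake u - 1) = true :=
  Finset.mem_filter

theorem succTime_step (c : Config n) (t : ℕ) (u : Fin n) :
    (step A ω t c).succTime u = if grabbers c ω t = {u} then some t else c.succTime u := by
  have : grabbers c ω t = {u ∈ ({u | ((c.wakeTime u).any fun s => ω (u, s) (t - s - 1)) = true} :
      Finset (Fin n)) | c.succTime u = none} := by
    ext v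
    rw [mem_grabbers, Config.mem_active, Finset.mem_filter, Finset.mem_filter, Config.wake]
    cases c.wakeTime v <;> simp [and_comm]
  rw [this]
  simp [step]

theorem succTime_succ (t : ℕ) (u : Fin n) :
    (config A ω (t + 1)).succTime u =
      if grabbers (config A ω t) ω t = {u} then some t else (config A ω t).succTime u :=
  succTime_step _ _ _

theorem succTime_lt {t : ℕ} {u : Fin n} {s : ℕ} (h : (config A ω t).succTime u = some s) :
    s < t := by
  induction t with
  | zero => simp [config] at h
  | succ t ih =>
    rw [succTime_succ] at h
    split_ifs at h with hc
    · simp at h; omega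
    · have := ih h; omega

theorem succTime_mono {t t' : ℕ} (htt : t ≤ t') {u : Fin n} {s : ℕ}
    (h : (config A ω t).succTime u = some s) : (config A ω t').succTime u = some s := by
  induction htt with
  | refl => exact h
  | @step m _ ih =>
    rw [succTime_succ, if_neg, ih]
    intro hc
    have : u ∈ grabbers (config A ω m) ω m := by rw [hc]; simp
    simp [mem_grabbers, Config.mem_active, ih] at this

theorem exists_succeedsAt {t : ℕ} {u : Fin n} {s : ℕ} (h : (config A ω t).succTime u = some s) :
    SucceedsAt A ω u s := by
  induction t with
  | zero => simp [config] at h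
  | succ t ih =>
    have h' := h
    rw [succTime_succ] at h'
    split_ifs at h' with hc
    · obtain rfl : t = s := by simpa using h'
      exact h
    · exact ih h'

theorem succeedsAt_unique {u : Fin n} {t t' : ℕ} (h : SucceedsAt A ω u t)
    (h' : SucceedsAt A ω u t') : t = t' := by
  rcases le_total t t' with hle | hle
  · have := (succTime_mono (Nat.succ_le_succ hle) h).symm.trans h'
    simpa using this
  · have := (succTime_mono (Nat.succ_le_succ hle) h').symm.trans h
    simpa using this.symm

/-- The transition in slot `t` depends only on the bits of that slot. -/
theorem measurable_step {c : Config n} {t : ℕ} (hc : ∀ u s, c.wakeTime u = some s → s < t)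
    (A : Adversary n) :
    Measurable[bitAlgebra n {t}] fun ω : Strings n => step A ω t c := by
  set g : Strings n → Fin n → Bool := fun ω u => (c.wakeTime u).any fun s => ω (u, s) (t - s - 1)
    with hg
  have hgm : Measurable[bitAlgebra n {t}] g := by
    refine @measurable_pi_lambda _ _ _ (bitAlgebra n {t}) _ _ fun u => ?_
    simp only [hg]
    cases hu : c.wakeTime u with
    | none => exact @measurable_const _ _ _ (bitAlgebra n {t}) false
    | some s =>
      have := hc u s hu
      have hk : bitSlot ((u, s), t - s - 1) ∈ ({t} : Set ℕ) := by
        simp only [bitSlot, Set.mem_singleton_iff]; omega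
      exact measurable_bitVar_bitAlgebra hk
  -- For fixed `c` the transition factors through one bit per party, and any map from the finite
  -- type `Fin n → Bool` is measurable.
  let h : (Fin n → Bool) → Config n := fun b =>
    let woken : Finset (Fin n) := {u ∈ A c.history | c.wakeTime u = none}
    let ones : Finset (Fin n) := {u | b u = true}
    let grab : Finset (Fin n) := {u ∈ ones | c.succTime u = none}
    { wakeTime := fun u => if u ∈ woken then some t else c.wakeTime u
      succTime := fun u => if grab = {u} then some t else c.succTime u
      history := (woken, ones) :: c.history }
  have hh : Measurable h := measurable_of_countable h
  exact hh.comp hgm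

/-- The sequence of configurations is adapted. -/
theorem measurable_config (A : Adversary n) (t : ℕ) :
    Measurable[pastFiltration n t] fun ω : Strings n => config A ω t := by
  induction t with
  | zero => exact @measurable_const _ _ _ (pastFiltration n 0) _
  | succ t ih =>
    have ih' : Measurable[pastFiltration n (t + 1)] fun ω : Strings n => config A ω t :=
      ih.mono ((pastFiltration n).mono (Nat.le_succ t)) le_rfl
    intro S _
    -- Which bits slot `t` reads depends on the random wake-up times. Splitting over the countably
    -- many values of the current configuration makes them deterministic.
    have : (fun ω : Strings n => config A ω (t + 1)) ⁻¹' S =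
        ⋃ c ∈ {c : Config n | ∀ u s, c.wakeTime u = some s → s < t},
          (fun ω => config A ω t) ⁻¹' {c} ∩ (fun ω => step A ω t c) ⁻¹' S := by
      ext ω
      simp only [Set.mem_preimage, Set.mem_iUnion, Set.mem_inter_iff, Set.mem_singleton_iff,
        exists_prop, Set.mem_ofPred_eq]
      constructor
      · intro h
        exact ⟨config A ω t, fun u s => wakeTime_lt, rfl, h⟩
      · rintro ⟨c, -, rfl, h⟩
        exact h
    rw [this]
    refine @MeasurableSet.biUnion _ _ (pastFiltration n (t + 1)) _ _ (Set.to_countable _)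
      fun c hc => ?_
    refine @MeasurableSet.inter _ (pastFiltration n (t + 1)) _ _ (ih' trivial) ?_
    exact bitAlgebra_mono (S := {t}) (by simp) _ (measurable_step hc A trivial)

end Execution

/-! ### The probability of a success -/

section Success

variable {n : ℕ} {D : Protocol} {A : Adversary n}

/-- The configuration `c` can occur just before slot `t`. -/
def Config.Before (c : Config n) (t : ℕ) : Prop := ∀ u s, c.wakeTime u = some s → s < t

theorem config_before (A : Adversary n) (ω : Strings n) (t : ℕ) : (config A ω t).Before t :=
  fun _ _ => wakeTime_lt

theorem Config.Before.wake_lt {c : Config n} {t : ℕ} (hc : c.Before t) {u : Fin n}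
    (hu : u ∈ c.active) : c.wake u < t := by
  obtain ⟨s, hs⟩ := Option.ne_none_iff_exists'.1 (Config.mem_active.1 hu).1
  simpa [Config.wake, hs] using hc u s hs

theorem measurableSet_config (t : ℕ) (P : Set (Config n)) :
    MeasurableSet[pastFiltration n t] {ω | config A ω t ∈ P} :=
  measurable_config A t trivial

/-- This turns a bound for a fixed configuration into one conditional on the past. On each piece
`config A ω t = c` of `E`, the transition uses only the bits of slot `t`, which are independent of
the past. -/
theorem mul_measure_le_of_step (hD : D.Memoryless) {t : ℕ} {P Q : Set (Config n)} {q : ENNReal}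
    (h : ∀ c : Config n, c.Before t → c ∈ P → q ≤ (D.prob n) {ω | step A ω t c ∈ Q})
    {E : Set (Strings n)} (hE : MeasurableSet[pastFiltration n t] E)
    (hEP : E ⊆ {ω | config A ω t ∈ P}) :
    q * (D.prob n) E ≤ (D.prob n) (E ∩ {ω | config A ω (t + 1) ∈ Q}) := by
  have hm : ∀ c, MeasurableSet[pastFiltration n t] (E ∩ {ω | config A ω t = c}) := fun c =>
    @MeasurableSet.inter _ (pastFiltration n t) _ _ hE (measurableSet_config t {c})
  have hm' : ∀ c, MeasurableSet (E ∩ {ω | config A ω t = c}) := fun c =>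
    (pastFiltration n).le t _ (hm c)
  have hQ : MeasurableSet {ω : Strings n | config A ω (t + 1) ∈ Q} :=
    (pastFiltration n).le (t + 1) _ (measurableSet_config (t + 1) Q)
  have e1 : E = ⋃ c, E ∩ {ω | config A ω t = c} := by ext; simp
  have e2 : E ∩ {ω | config A ω (t + 1) ∈ Q} =
      ⋃ c, (E ∩ {ω | config A ω t = c}) ∩ {ω | config A ω (t + 1) ∈ Q} := by
    rw [← Set.iUnion_inter, ← e1]
  have hdis : Pairwise (Function.onFun Disjoint fun c => E ∩ {ω | config A ω t = c}) := by
    intro c c' hcc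
    refine Set.disjoint_left.2 fun ω h1 h2 => hcc (h1.2.symm.trans h2.2)
  rw [e2, measure_iUnion (fun c c' hcc => (hdis hcc).mono Set.inter_subset_left
    Set.inter_subset_left) fun c => (hm' c).inter hQ]
  conv_lhs => rw [e1, measure_iUnion hdis hm', ← ENNReal.tsum_mul_left]
  refine ENNReal.tsum_le_tsum fun c => ?_
  rcases (E ∩ {ω | config A ω t = c}).eq_empty_or_nonempty with he | ⟨ω₀, hω₀, rfl⟩
  · simp [he]
  · set c := config A ω₀ t with hc
    have e3 : (E ∩ {ω | config A ω t = c}) ∩ {ω | config A ω (t + 1) ∈ Q} =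
        (E ∩ {ω | config A ω t = c}) ∩ {ω | step A ω t c ∈ Q} := by
      ext ω
      simp only [Set.mem_inter_iff, Set.mem_ofPred_eq, config]
      exact ⟨fun ⟨⟨h1, h2⟩, h3⟩ => ⟨⟨h1, h2⟩, h2 ▸ h3⟩, fun ⟨⟨h1, h2⟩, h3⟩ => ⟨⟨h1, h2⟩, h2 ▸ h3⟩⟩
    have hind := (Indep_iff _ _ _).1
      (indep_bitAlgebra (n := n) hD (S := Set.Iio t) (T := {t}) (by simp)) _ _ (hm c)
      ((measurable_step (config_before A ω₀ t) A) (show MeasurableSet Q from trivial))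
    rw [e3]
    refine le_trans ?_ hind.ge
    rw [mul_comm]
    gcongr
    exact h c (config_before A ω₀ t) (hEP hω₀)

/-- The sum of the grab probabilities of the active parties. -/
noncomputable def Protocol.contention (D : Protocol) (c : Config n) (t : ℕ) : ℝ :=
  ∑ v ∈ c.active, D.grabProb t (c.wake v)

theorem exp_neg_two_mul_le {p : ℝ} (h0 : 0 ≤ p) (h : p ≤ 1 / 2) : Real.exp (-(2 * p)) ≤ 1 - p := by
  rw [Real.exp_neg, inv_le_comm₀ (Real.exp_pos _) (by linarith)]
  refine le_trans ?_ (Real.add_one_le_exp _)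
  rw [inv_le_iff_one_le_mul₀ (by linarith)]
  nlinarith

theorem measurableSet_grabbers (c : Config n) (t : ℕ) (S : Finset (Fin n)) :
    MeasurableSet {ω : Strings n | grabbers c ω t = S} := by
  have h : Measurable fun (ω : Strings n) (u : Fin n) => ω (u, c.wake u) (t - c.wake u - 1) := by
    fun_prop
  exact h (show MeasurableSet {b : Fin n → Bool | {u ∈ c.active | b u = true} = S} from
    Set.Countable.measurableSet (Set.to_countable _))

/-- By independence, `u` grabs alone with probability `p_u ∏ (1 - p_v)` over the other active `v`,
and `1 - p ≥ exp (-2 p)` for `p ≤ 1 / 2`. This is where the cap `1 / 2` in the protocol is needed.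
-/
theorem prob_grabbers_eq_ge (hD : D.Memoryless) (hp : ∀ t s, s < t → D.grabProb t s ≤ 1 / 2)
    {c : Config n} {t : ℕ} (hc : c.Before t) {u : Fin n} (hu : u ∈ c.active) :
    ENNReal.ofReal (D.grabProb t (c.wake u) * Real.exp (-(2 * D.contention c t))) ≤
      (D.prob n) {ω | grabbers c ω t = {u}} := by
  let k : Fin n → (Fin n × ℕ) × ℕ := fun v => ((v, c.wake v), t - c.wake v - 1)
  have hk : Function.Injective k := fun v w h => by simpa [k] using congrArg (fun x => x.1.1) h
  have hslot : ∀ v ∈ c.active, bitSlot (k v) = t := fun v hv => by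
    have := hc.wake_lt hv
    simp only [bitSlot, k]; omega
  have hind := ((iIndepFun_bitVar (n := n) hD).precomp hk).measure_inter_preimage_eq_mul c.active
    (sets := fun v => {b | b = decide (v = u)}) fun v _ =>
      Set.Countable.measurableSet (Set.to_countable _)
  have hsub : (⋂ v ∈ c.active, bitVar (k v) ⁻¹' {b | b = decide (v = u)}) ⊆
      {ω | grabbers c ω t = {u}} := by
    intro ω hω
    simp only [Set.mem_iInter, Set.mem_preimage, Set.mem_ofPred_eq] at hω
    ext v
    rw [mem_grabbers, Finset.mem_singleton]
    constructor
    · rintro ⟨hv, h⟩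
      have := hω v hv
      rw [show bitVar (k v) ω = true from h] at this
      simpa using this.symm
    · rintro rfl
      refine ⟨hu, ?_⟩
      have := hω v hu
      rwa [decide_eq_true rfl] at this
  refine le_trans ?_ (measure_mono hsub)
  refine le_trans ?_ hind.ge
  rw [ ← Finset.mul_prod_erase _ _ hu]
  have h1 : (D.prob n) (bitVar (k u) ⁻¹' {b | b = decide (u = u)}) =
      ENNReal.ofReal (D.grabProb t (c.wake u)) := by
    have := prob_bitVar_true (D := D) (k u)
    rw [hslot u hu] at this
    rw [show bitVar (k u) ⁻¹' {b | b = decide (u = u)} = {ω | bitVar (k u) ω = true} by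
      rw [decide_eq_true rfl]; rfl]
    exact this
  have h2 : ∀ v ∈ c.active.erase u, (D.prob n) (bitVar (k v) ⁻¹' {b | b = decide (v = u)}) =
      ENNReal.ofReal (1 - D.grabProb t (c.wake v)) := by
    intro v hv
    obtain ⟨hvu, hv⟩ := Finset.mem_erase.1 hv
    have := prob_bitVar_false (D := D) (k v)
    rw [hslot v hv] at this
    rw [show bitVar (k v) ⁻¹' {b | b = decide (v = u)} = {ω | bitVar (k v) ω = false} by
      rw [decide_eq_false hvu]; rfl]
    exact this
  have h3 : ∀ v ∈ c.active, 0 ≤ 1 - D.grabProb t (c.wake v) := fun v hv => by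
    have := hp t _ (hc.wake_lt hv); linarith
  rw [h1, Finset.prod_congr rfl h2, ← ENNReal.ofReal_prod_of_nonneg
    (fun v hv => h3 v (Finset.mem_of_mem_erase hv)), ← ENNReal.ofReal_mul (grabProb_nonneg _ _)]
  refine ENNReal.ofReal_le_ofReal (mul_le_mul_of_nonneg_left ?_ (grabProb_nonneg _ _))
  calc Real.exp (-(2 * D.contention c t))
      ≤ Real.exp (∑ v ∈ c.active.erase u, -(2 * D.grabProb t (c.wake v))) := by
        refine Real.exp_le_exp.2 ?_
        rw [Finset.sum_neg_distrib, neg_le_neg_iff, ← Finset.mul_sum, Protocol.contention]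
        refine mul_le_mul_of_nonneg_left ?_ zero_le_two
        exact Finset.sum_le_sum_of_subset_of_nonneg (Finset.erase_subset _ _)
          fun _ _ _ => grabProb_nonneg _ _
    _ = ∏ v ∈ c.active.erase u, Real.exp (-(2 * D.grabProb t (c.wake v))) := Real.exp_sum _ _
    _ ≤ _ := Finset.prod_le_prod (fun _ _ => (Real.exp_pos _).le) fun v hv =>
        exp_neg_two_mul_le (grabProb_nonneg _ _)
          (hp t _ (hc.wake_lt (Finset.mem_of_mem_erase hv)))

theorem prob_exists_grabbers_eq_ge (hD : D.Memoryless)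
    (hp : ∀ t s, s < t → D.grabProb t s ≤ 1 / 2) {c : Config n} {t : ℕ} (hc : c.Before t) :
    ENNReal.ofReal (D.contention c t * Real.exp (-(2 * D.contention c t))) ≤
      (D.prob n) {ω | ∃ u, grabbers c ω t = {u}} := by
  have hsub : (⋃ u ∈ c.active, {ω : Strings n | grabbers c ω t = {u}}) ⊆
      {ω | ∃ u, grabbers c ω t = {u}} := by
    intro ω hω
    simp only [Set.mem_iUnion] at hω
    obtain ⟨u, -, h⟩ := hω
    exact ⟨u, h⟩
  refine le_trans ?_ (measure_mono hsub)
  rw [measure_biUnion_finset]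
  · conv_lhs => rw [Protocol.contention, Finset.sum_mul]
    rw [ENNReal.ofReal_sum_of_nonneg fun u _ =>
      mul_nonneg (grabProb_nonneg _ _) (Real.exp_pos _).le]
    exact Finset.sum_le_sum fun u hu => prob_grabbers_eq_ge hD hp hc hu
  · intro u _ v _ huv
    refine Set.disjoint_left.2 fun ω h1 h2 => huv ?_
    simpa using (show grabbers c ω t = {u} from h1).symm.trans h2
  · exact fun u _ => measurableSet_grabbers c t {u}

theorem exp_four_le : Real.exp 4 ≤ 64 := by
  have h := Real.exp_one_lt_d9
  have : Real.exp 4 = Real.exp 1 ^ 4 := by rw [← Real.exp_nat_mul]; norm_num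
  rw [this]
  calc Real.exp 1 ^ 4 ≤ 2.72 ^ 4 := by gcongr; linarith
    _ ≤ 64 := by norm_num

theorem exp_two_le : Real.exp 2 ≤ 8 := by
  have : Real.exp 4 = Real.exp 2 ^ 2 := by rw [← Real.exp_nat_mul]; norm_num
  have := exp_four_le
  nlinarith [Real.exp_pos 2]

/-- The contention lies in `[1/8, 2]`. -/
def Protocol.moderate (D : Protocol) (n t : ℕ) : Set (Config n) :=
  {c | 1 / 8 ≤ D.contention c t ∧ D.contention c t ≤ 2}

/-- Party `u` is active, the contention is at most `1`, and `u` grabs with probability at least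
`p`. -/
def Protocol.favorable (D : Protocol) (u : Fin n) (p : ℝ) (t : ℕ) : Set (Config n) :=
  {c | u ∈ c.active ∧ D.contention c t ≤ 1 ∧ p ≤ D.grabProb t (c.wake u)}

theorem hits_success_le (B : ℕ → Set (Strings n)) (ω : Strings n) (T : ℕ) :
    hits (fun t => B t ∩ {ω | config A ω (t + 1) ∈ {c | ∃ u, c.succTime u = some t}}) ω T ≤ n := by
  have := hits_le_card (B := fun t => B t ∩ {ω | config A ω (t + 1) ∈
    {c | ∃ u, c.succTime u = some t}}) (SucceedsAt A ω) (fun _ ht => ht.2)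
    (fun _ _ _ => succeedsAt_unique) T
  rwa [Fintype.card_fin] at this

theorem hits_success_party_le (B : ℕ → Set (Strings n)) (u : Fin n) (ω : Strings n) (T : ℕ) :
    hits (fun t => B t ∩ {ω | config A ω (t + 1) ∈ {c | c.succTime u = some t}}) ω T ≤ 1 :=
  hits_le_card (α := Unit) (fun _ => SucceedsAt A ω u) (fun _ ht => ⟨(), ht.2⟩)
    (fun _ _ _ => succeedsAt_unique) T

/-- Slots with moderate contention are rare, as they often lead to a success. -/
theorem prob_moderate_le (hD : D.Memoryless) (hp : ∀ t s, s < t → D.grabProb t s ≤ 1 / 2)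
    (A : Adversary n) (M : ℕ) :
    (D.prob n) {ω | ∃ T, M ≤ hits (fun t => {ω | config A ω t ∈ D.moderate n t}) ω T} ≤
      ENNReal.ofReal (Real.exp (n - 1 / 512 / 2 * M)) := by
  refine measure_exists_le_hits (F := pastFiltration n)
    (Z := fun t => {ω | config A ω (t + 1) ∈ {c | ∃ u, c.succTime u = some t}})
    (fun t => measurableSet_config t _) (fun t => measurableSet_config (t + 1) _) (by norm_num)
    (fun t E hE hEB => mul_measure_le_of_step hD ?_ hE hEB) (fun ω T => hits_success_le _ ω T) M
  rintro c hc ⟨h1, h2⟩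
  have hsub : {ω : Strings n | ∃ u, grabbers c ω t = {u}} ⊆
      {ω | step A ω t c ∈ {c | ∃ u, c.succTime u = some t}} := by
    rintro ω ⟨u, hu⟩
    exact ⟨u, by rw [succTime_step, if_pos hu]⟩
  refine le_trans ?_ ((prob_exists_grabbers_eq_ge hD hp hc).trans (measure_mono hsub))
  -- For contention `x` in `[1 / 8, 2]`, `x * exp (-2 x) ≥ 1 / 8 * exp (-4) ≥ 1 / 512`.
  refine ENNReal.ofReal_le_ofReal ?_
  have h3 : (1 : ℝ) / 64 ≤ Real.exp (-(2 * D.contention c t)) := by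
    calc (1 : ℝ) / 64 ≤ Real.exp (-4) := by
          rw [Real.exp_neg, one_div]
          exact inv_anti₀ (Real.exp_pos _) exp_four_le
      _ ≤ _ := Real.exp_le_exp.2 (by linarith)
  calc (1 : ℝ) / 512 = 1 / 8 * (1 / 64) := by norm_num
    _ ≤ _ := by gcongr

/-- Slots that are favorable to `u` are rare, as they may lead to a success of `u`. -/
theorem prob_favorable_le (hD : D.Memoryless) (hp : ∀ t s, s < t → D.grabProb t s ≤ 1 / 2)
    (A : Adversary n) (u : Fin n) {p : ℝ} (hp0 : 0 ≤ p) (M : ℕ) :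
    (D.prob n) {ω | ∃ T, M ≤ hits (fun t => {ω | config A ω t ∈ D.favorable u p t}) ω T} ≤
      ENNReal.ofReal (Real.exp (1 - p / 8 / 2 * M)) := by
  have := measure_exists_le_hits (F := pastFiltration n) (μ := D.prob n) (q := p / 8) (k := 1)
    (B := fun t => {ω | config A ω t ∈ D.favorable u p t})
    (Z := fun t => {ω | config A ω (t + 1) ∈ {c | c.succTime u = some t}})
    (fun t => measurableSet_config t _) (fun t => measurableSet_config (t + 1) _) (by positivity)
    (fun t E hE hEB => mul_measure_le_of_step hD ?_ hE hEB)
    (fun ω T => hits_success_party_le _ u ω T) M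
  · simpa using this
  rintro c hc ⟨h1, h2, h3⟩
  have hsub : {ω : Strings n | grabbers c ω t = {u}} ⊆
      {ω | step A ω t c ∈ {c | c.succTime u = some t}} := by
    intro ω hu
    show (step A ω t c).succTime u = some t
    rw [succTime_step, if_pos (show grabbers c ω t = {u} from hu)]
  refine le_trans ?_ ((prob_grabbers_eq_ge hD hp hc h1).trans (measure_mono hsub))
  refine ENNReal.ofReal_le_ofReal ?_
  have h4 : (1 : ℝ) / 8 ≤ Real.exp (-(2 * D.contention c t)) := by
    calc (1 : ℝ) / 8 ≤ Real.exp (-2) := by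
          rw [Real.exp_neg, one_div]
          exact inv_anti₀ (Real.exp_pos _) exp_two_le
      _ ≤ _ := Real.exp_le_exp.2 (by linarith)
  calc p / 8 = p * (1 / 8) := by ring
    _ ≤ _ := mul_le_mul h3 h4 (by norm_num) (grabProb_nonneg _ _)

end Success

/-! ### The function `ζ` -/

theorem iterLog_zero (x : ℝ) : iterLog 0 x = x := rfl

theorem one_le_logb_two {x : ℝ} (hx : 2 ≤ x) : 1 ≤ Real.logb 2 x := by
  rw [Real.le_logb_iff_rpow_le (by norm_num) (by linarith)]
  simpa using hx

/-- The tangent of the binary logarithm at `2` has slope less than `3/4`. -/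
theorem logb_two_le {x : ℝ} (hx : 2 ≤ x) : Real.logb 2 x ≤ 1 + 3 / 4 * (x - 2) := by
  have h1 : Real.log x = Real.log 2 + Real.log (x / 2) := by
    rw [← Real.log_mul (by norm_num) (by linarith)]; congr 1; ring
  have h2 := Real.log_le_sub_one_of_pos (show 0 < x / 2 by linarith)
  have h3 := Real.log_two_gt_d9
  rw [Real.logb, div_le_iff₀ (by linarith), h1]
  nlinarith

/-- For `x ≥ 2` the logarithm lowers `x` by more than `1 / 4`, so an ordinary induction on the
number of quarters above 2 suffices. The principle matches the recursion `zeta_of_le`. -/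
theorem iteratedLog_induction {P : ∀ x : ℝ, 1 ≤ x → Prop} (h1 : ∀ x hx, x < 2 → P x hx)
    (h2 : ∀ x (hx : 2 ≤ x), P (Real.logb 2 x) (one_le_logb_two hx) → P x (one_le_two.trans hx))
    (x : ℝ) (hx : 1 ≤ x) : P x hx := by
  have key : ∀ k : ℕ, ∀ (x : ℝ) (hx : 1 ≤ x), x < 2 + k / 4 → P x hx := by
    intro k
    induction k with
    | zero => intro x hx hlt; exact h1 x hx (by simpa using hlt)
    | succ k ih =>
      intro x hx hlt
      push_cast at hlt
      rcases lt_or_ge x 2 with h | h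
      · exact h1 x hx h
      · refine h2 x h (ih _ (one_le_logb_two h) ?_)
        have := logb_two_le h
        linarith
  refine key (⌈4 * x⌉₊) x hx ?_
  have := Nat.le_ceil (4 * x)
  linarith

theorem exists_iterLog_lt {x : ℝ} (hx : 1 ≤ x) : ∃ i, iterLog i x < 2 := by
  induction x, hx using iteratedLog_induction with
  | h1 x _ h => exact ⟨0, h⟩
  | h2 x _ ih =>
    obtain ⟨i, hi⟩ := ih
    exact ⟨i + 1, hi⟩

theorem zeta_of_lt {x : ℝ} (h : x < 2) : zeta x = 2 * x := by
  have : logStar x = 0 := by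
    rw [logStar, Nat.sInf_eq_zero]
    exact Or.inl h
  simp [zeta, this, iterLog_zero]

theorem zeta_of_le {x : ℝ} (h : 2 ≤ x) : zeta x = 2 * x * zeta (Real.logb 2 x) := by
  obtain ⟨i, hi⟩ := exists_iterLog_lt (show 1 ≤ x by linarith)
  have hne : 1 ≤ logStar x := by
    rw [Nat.one_le_iff_ne_zero]
    intro h0
    have := Nat.sInf_mem (s := {i | iterLog i x < 2}) ⟨i, hi⟩
    rw [show sInf {i | iterLog i x < 2} = 0 from h0] at this
    exact absurd this (by simpa [iterLog_zero] using h)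
  have : logStar x = logStar (Real.logb 2 x) + 1 :=
    (Nat.sInf_add (p := fun i => iterLog i x < 2) hne).symm
  rw [zeta, this, Finset.prod_range_succ', iterLog_zero, mul_comm]
  rfl

theorem two_mul_le_zeta {x : ℝ} (hx : 1 ≤ x) : 2 * x ≤ zeta x := by
  induction x, hx using iteratedLog_induction with
  | h1 x _ h => rw [zeta_of_lt h]
  | h2 x h ih =>
    rw [zeta_of_le h]
    have := one_le_logb_two h
    nlinarith

/-- A crude bound that starts a bootstrap: each use of `ζ(x) = 2x ζ(log x)` removes one exponential,
giving first `zeta_le_pow` and then `zeta_le_mul_logb_pow`. -/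
theorem zeta_le_rpow {x : ℝ} (hx : 1 ≤ x) : zeta x ≤ (2 : ℝ) ^ (10 * x) := by
  induction x, hx using iteratedLog_induction with
  | h1 x h h' =>
    rw [zeta_of_lt h']
    calc 2 * x ≤ (2 : ℝ) ^ (2 : ℝ) := by norm_num; linarith
      _ ≤ _ := Real.rpow_le_rpow_of_exponent_le (by norm_num) (by linarith)
  | h2 x h ih =>
    have hx0 : 0 < x := by linarith
    rw [zeta_of_le h]
    calc 2 * x * zeta (Real.logb 2 x) ≤ 2 * x * (2 : ℝ) ^ (10 * Real.logb 2 x) := by gcongr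
      _ = (2 : ℝ) ^ (1 + Real.logb 2 x + 10 * Real.logb 2 x) := by
        rw [Real.rpow_add (by norm_num), Real.rpow_add (by norm_num), Real.rpow_one,
          Real.rpow_logb (by norm_num) (by norm_num) hx0]
      _ ≤ _ := by
        refine Real.rpow_le_rpow_of_exponent_le (by norm_num) ?_
        have := logb_two_le h
        linarith

theorem zeta_le_pow {x : ℝ} (hx : 2 ≤ x) : zeta x ≤ 2 * x ^ 11 := by
  have hx0 : 0 < x := by linarith
  rw [zeta_of_le hx]
  calc 2 * x * zeta (Real.logb 2 x) ≤ 2 * x * (2 : ℝ) ^ (10 * Real.logb 2 x) := by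
        gcongr; exact zeta_le_rpow (one_le_logb_two hx)
    _ = 2 * x * x ^ 10 := by
        rw [mul_comm (10 : ℝ), Real.rpow_mul (by norm_num),
          Real.rpow_logb (by norm_num) (by norm_num) hx0]
        norm_cast
    _ = 2 * x ^ 11 := by ring

theorem zeta_le_mul_logb_pow {x : ℝ} (hx : 4 ≤ x) : zeta x ≤ 4 * x * Real.logb 2 x ^ 11 := by
  have h2 : 2 ≤ Real.logb 2 x := by
    rw [Real.le_logb_iff_rpow_le (by norm_num) (by linarith)]
    norm_num; exact hx
  rw [zeta_of_le (by linarith)]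
  calc 2 * x * zeta (Real.logb 2 x) ≤ 2 * x * (2 * Real.logb 2 x ^ 11) := by
        gcongr; exact zeta_le_pow h2
    _ = _ := by ring

/-! ### The growth `n (log log n)^(1 + o(1))` of the latency bound -/

theorem exists_exponent (C : ℝ) (hC : 0 < C) : ∃ ε : ℕ → ℝ, Tendsto ε atTop (𝓝 0) ∧
    ∀ᶠ n : ℕ in atTop, C * ((n : ℝ) * zeta (4 * Real.logb 2 (Real.logb 2 n))) =
      (n : ℝ) * (Real.logb 2 (Real.logb 2 n)) ^ (1 + ε n) := by
  have hy : Tendsto (fun n : ℕ => Real.logb 2 (Real.logb 2 n)) atTop atTop :=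
    (Real.tendsto_logb_atTop (by norm_num)).comp
      ((Real.tendsto_logb_atTop (by norm_num)).comp tendsto_natCast_atTop_atTop)
  -- The exponent is obtained by solving the required identity. It tends to 0 because `8 y ≤ ζ(4y) ≤
  -- 16 y (log 4y)^11`.
  let e : ℝ → ℝ := fun y => Real.log (C * zeta (4 * y)) / Real.log y - 1
  have hpos : ∀ y : ℝ, 2 ≤ y → 0 < zeta (4 * y) := fun y h2 => by
    have := two_mul_le_zeta (show 1 ≤ 4 * y by linarith); linarith
  refine ⟨fun n => e (Real.logb 2 (Real.logb 2 n)), Tendsto.comp (g := e) (y := atTop) ?_ hy, ?_⟩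
  · have hlog : Tendsto (fun y : ℝ => Real.log y) atTop atTop := Real.tendsto_log_atTop
    have hlow : Tendsto (fun y : ℝ => Real.log (8 * C) / Real.log y) atTop (𝓝 0) :=
      hlog.const_div_atTop _
    have hll : Tendsto (fun y : ℝ => Real.log (Real.log y) / Real.log y) atTop (𝓝 0) :=
      (Real.isLittleO_log_id_atTop.tendsto_div_nhds_zero).comp hlog
    have hup : Tendsto (fun y : ℝ => Real.log (16 * C * (3 / Real.log 2) ^ 11) / Real.log y +
        11 * (Real.log (Real.log y) / Real.log y)) atTop (𝓝 0) := by
      have := (hlog.const_div_atTop (Real.log (16 * C * (3 / Real.log 2) ^ 11))).add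
        (hll.const_mul 11)
      simpa using this
    have hl2 : 0 < Real.log 2 := Real.log_pos (by norm_num)
    refine tendsto_of_tendsto_of_tendsto_of_le_of_le' hlow hup ?_ ?_
    · filter_upwards [eventually_ge_atTop 2] with y h2
      have hly : 0 < Real.log y := Real.log_pos (by linarith)
      simp only [e]
      rw [le_sub_iff_add_le, div_add_one hly.ne', ← Real.log_mul (by positivity) (by linarith)]
      refine div_le_div_of_nonneg_right (Real.log_le_log (by positivity) ?_) hly.le
      have := two_mul_le_zeta (show 1 ≤ 4 * y by linarith)
      nlinarith
    · filter_upwards [eventually_ge_atTop 2] with y h2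
      have hly : 0 < Real.log y := Real.log_pos (by linarith)
      have hz := hpos y h2
      simp only [e]
      rw [sub_le_iff_le_add, ← mul_div_assoc, ← add_div, div_add_one hly.ne']
      gcongr
      have h4 : Real.logb 2 (4 * y) ≤ 3 / Real.log 2 * Real.log y := by
        rw [Real.logb, div_mul_eq_mul_div]
        gcongr
        rw [Real.log_mul (by norm_num) (by linarith),
          show (4 : ℝ) = 2 ^ 2 by norm_num, Real.log_pow]
        have := Real.log_le_log (by norm_num) h2
        push_cast
        linarith
      have h40 : 0 ≤ Real.logb 2 (4 * y) := Real.logb_nonneg (by norm_num) (by linarith)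
      calc Real.log (C * zeta (4 * y))
          ≤ Real.log (16 * C * (3 / Real.log 2) ^ 11 * Real.log y ^ 11 * y) := by
            refine Real.log_le_log (by positivity) ?_
            calc C * zeta (4 * y) ≤ C * (4 * (4 * y) * Real.logb 2 (4 * y) ^ 11) := by
                  gcongr; exact zeta_le_mul_logb_pow (by linarith)
              _ ≤ C * (4 * (4 * y) * (3 / Real.log 2 * Real.log y) ^ 11) := by gcongr
              _ = _ := by ring
        _ = _ := by
            rw [Real.log_mul (by positivity) (by linarith),
              Real.log_mul (by positivity) (by positivity), Real.log_pow]
            norm_num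
  · filter_upwards [hy.eventually_ge_atTop 2] with n h2
    set y := Real.logb 2 (Real.logb 2 n)
    have hly : 0 < Real.log y := Real.log_pos (by linarith)
    have hz := hpos y h2
    have : y ^ (1 + e y) = C * zeta (4 * y) := by
      rw [Real.rpow_def_of_pos (by linarith)]
      simp only [e]
      rw [add_sub_cancel, mul_div_cancel₀ _ hly.ne', Real.exp_log (by positivity)]
    rw [this]; ring

/-! ### The sequence `a'` -/

theorem elias_eq {t N : ℕ} (hN : 1 ≤ N) (h : IsPrefixOf (eliasCode N) (revBits t)) :
    elias t = N :=
  eliasCode_unique (exists_eliasCode t).choose_spec.1 hN (exists_eliasCode t).choose_spec.2 h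

/-- As the least significant bit comes first, having the prefix `l` means lying in a residue class
modulo `2 ^ l.length`. -/
theorem exists_isPrefixOf_revBits (l : List Bool) (t₀ : ℕ) :
    ∃ t, t₀ ≤ t ∧ t < t₀ + 2 ^ l.length ∧ IsPrefixOf l (revBits t) := by
  set r := Nat.ofBits fun i : Fin l.length => l[i] with hr
  have hpos : 0 < 2 ^ l.length := by positivity
  have hrl : r < 2 ^ l.length := Nat.ofBits_lt_two_pow _
  obtain ⟨t, h1, h2, h3⟩ : ∃ t, t₀ ≤ t ∧ t < t₀ + 2 ^ l.length ∧ t % 2 ^ l.length = r := by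
    have hm := Nat.mod_lt t₀ hpos
    have hd := Nat.mod_add_div t₀ (2 ^ l.length)
    rcases le_or_gt (t₀ % 2 ^ l.length) r with h | h
    · refine ⟨r + 2 ^ l.length * (t₀ / 2 ^ l.length), by omega, by omega, ?_⟩
      rw [Nat.add_mul_mod_self_left, Nat.mod_eq_of_lt hrl]
    · refine ⟨r + 2 ^ l.length * (t₀ / 2 ^ l.length + 1), ?_, ?_, ?_⟩
      · rw [mul_add]; omega
      · rw [mul_add]; omega
      · rw [Nat.add_mul_mod_self_left, Nat.mod_eq_of_lt hrl]
  refine ⟨t, h1, h2, fun i hi => ?_⟩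
  have h4 : (t % 2 ^ l.length).testBit i = t.testBit i := by
    rw [Nat.testBit_mod_two_pow]; simp [hi]
  rw [revBits, ← h4, h3, hr, Nat.testBit_ofBits_lt _ _ hi]
  rfl

theorem exists_elias'_eq (z : ℤ) : ∃ N : ℕ, 1 ≤ N ∧ N ≤ 2 * z.natAbs + 1 ∧
    ∀ t, elias t = N → elias' t = z := by
  rcases lt_or_ge 0 z with h | h
  · refine ⟨2 * z.natAbs, by omega, by omega, fun t ht => ?_⟩
    rw [elias', ht, Nat.mul_mod_right, Nat.mul_div_cancel_left _ (by norm_num)]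
    simp [abs_of_pos h]
  · refine ⟨2 * z.natAbs + 1, by omega, le_rfl, fun t ht => ?_⟩
    rw [elias', ht, Nat.mul_add_mod, show (2 * z.natAbs + 1) / 2 = z.natAbs by omega]
    simp [abs_of_nonpos h]

/-- The code and `ζ` obey the same recursion: the group `Bin(N)` contributes `2 ^ (⌊log N⌋ + 1) ≤
2x`, and the remaining groups encode `⌊log N⌋ ≤ log x`. The closing zero pays for the last factor of
`ζ`. -/
theorem two_pow_length_eliasCode_le {x : ℝ} (hx : 1 ≤ x) {N : ℕ} (hN : 1 ≤ N) (hNx : (N : ℝ) ≤ x) :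
    (2 : ℝ) ^ (eliasCode N).length ≤ zeta x := by
  rw [eliasCode, List.length_append, List.length_singleton, pow_succ]
  induction x, hx using iteratedLog_induction generalizing N with
  | h1 x h h' =>
    have : N < 2 := by exact_mod_cast hNx.trans_lt h'
    rw [zeta_of_lt h', eliasGroups_of_lt (by omega)]
    simp; linarith
  | h2 x h ih =>
    rcases lt_or_ge N 2 with hN2 | hN2
    · rw [eliasGroups_of_lt (by omega)]
      have := two_mul_le_zeta (show 1 ≤ x by linarith)
      simp; linarith
    · have hlog : ((Nat.log 2 N : ℕ) : ℝ) ≤ Real.logb 2 x := by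
        rw [Real.le_logb_iff_rpow_le (by norm_num) (by linarith), Real.rpow_natCast]
        refine le_trans ?_ hNx
        exact_mod_cast Nat.pow_log_le_self 2 (by omega)
      have h1 := ih (Nat.log_pos (by norm_num) hN2) hlog
      have hlen : (bin N).length = Nat.log 2 N + 1 := by simp [bin, bits_length N (by omega)]
      have h3 : (2 : ℝ) ^ (Nat.log 2 N) ≤ N := by exact_mod_cast Nat.pow_log_le_self 2 (by omega)
      rw [zeta_of_le h, eliasGroups_of_le hN2, List.length_append, pow_add, hlen,
        pow_succ 2 (Nat.log 2 N)]
      calc _ = 2 * (2 : ℝ) ^ (Nat.log 2 N) * (2 ^ (eliasGroups (Nat.log 2 N)).length * 2) := by ring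
        _ ≤ 2 * x * zeta (Real.logb 2 x) := by gcongr; exact h3.trans hNx

theorem exists_period (z : ℤ) {x : ℝ} (hx : 1 ≤ x) (hz : 2 * (z.natAbs : ℝ) + 1 ≤ x) :
    ∃ p : ℕ, (p : ℝ) ≤ zeta x ∧ ∀ t₀, ∃ t, t₀ ≤ t ∧ t < t₀ + p ∧ elias' t = z := by
  obtain ⟨N, hN, hNz, h⟩ := exists_elias'_eq z
  have hNx : (N : ℝ) ≤ x := le_trans (by exact_mod_cast hNz) hz
  refine ⟨2 ^ (eliasCode N).length, by exact_mod_cast two_pow_length_eliasCode_le hx hN hNx, ?_⟩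
  intro t₀
  obtain ⟨t, h1, h2, h3⟩ := exists_isPrefixOf_revBits (eliasCode N) t₀
  exact ⟨t, h1, h2, h t (elias_eq hN h3)⟩

/-! ### Counting windows -/

section Windows

variable {n : ℕ} {D : Protocol} {A : Adversary n} {ω : Strings n}

theorem window_unique {r P x i j : ℕ} (hi : r + i * P ≤ x ∧ x < r + i * P + P)
    (hj : r + j * P ≤ x ∧ x < r + j * P + P) : i = j := by
  rcases lt_trichotomy i j with h | h | h
  · have := Nat.mul_le_mul_right P (Nat.succ_le_of_lt h)
    rw [Nat.succ_mul] at this; omega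
  · exact h
  · have := Nat.mul_le_mul_right P (Nat.succ_le_of_lt h)
    rw [Nat.succ_mul] at this; omega

/-- Elements up to `J` contribute at most the harmonic number of `J`; the others number at most `J`,
each contributing less than `1 / J`. -/
theorem sum_inv_le {S : Finset ℕ} {J : ℕ} (hS : S.card ≤ J) (h0 : ∀ a ∈ S, 0 < a) :
    ∑ a ∈ S, (a : ℝ)⁻¹ ≤ 2 + Real.log J := by
  have h1 : ∑ a ∈ S with a ≤ J, (a : ℝ)⁻¹ ≤ 1 + Real.log J := by
    refine le_trans ?_ (harmonic_le_one_add_log J)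
    rw [harmonic_eq_sum_Icc]
    push_cast
    refine Finset.sum_le_sum_of_subset_of_nonneg (fun a ha => ?_) fun _ _ _ => by positivity
    obtain ⟨ha, haJ⟩ := Finset.mem_filter.1 ha
    exact Finset.mem_Icc.2 ⟨h0 a ha, haJ⟩
  have h2 : ∑ a ∈ S with ¬ a ≤ J, (a : ℝ)⁻¹ ≤ 1 := by
    rcases Nat.eq_zero_or_pos J with rfl | hJ
    · rw [Finset.card_eq_zero.1 (Nat.le_zero.1 hS)]; simp
    · calc ∑ a ∈ S with ¬ a ≤ J, (a : ℝ)⁻¹ ≤ ∑ a ∈ S with ¬ a ≤ J, (J : ℝ)⁻¹ := by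
            refine Finset.sum_le_sum fun a ha => ?_
            have := (Finset.mem_filter.1 ha).2
            gcongr
            omega
        _ ≤ J * (J : ℝ)⁻¹ := by
            rw [Finset.sum_const, nsmul_eq_mul]
            gcongr
            exact (Finset.card_filter_le _ _).trans hS
        _ = 1 := mul_inv_cancel₀ (by positivity)
  rw [← Finset.sum_filter_add_sum_filter_not S (fun a => a ≤ J)]
  linarith

/-- The sum of the inverse ages of the active parties. -/
noncomputable def Config.load (c : Config n) (t : ℕ) : ℝ :=
  ∑ v ∈ c.active, ((t : ℝ) - c.wake v)⁻¹

/-- During the `P` slots before `τ` no party is woken up, and during the `P` slots from `τ` on no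
party is woken up or successful. -/
def Quiet (A : Adversary n) (ω : Strings n) (τ P : ℕ) : Prop :=
  (∀ v s, (config A ω (τ + P)).wakeTime v = some s → s + P < τ) ∧
    ∀ v t, SucceedsAt A ω v t → t < τ ∨ τ + P ≤ t

theorem wakeTime_eq_some_wake {c : Config n} {v : Fin n} (hv : v ∈ c.active) :
    c.wakeTime v = some (c.wake v) := by
  obtain ⟨s, hs⟩ := Option.ne_none_iff_exists'.1 (Config.mem_active.1 hv).1
  simp [Config.wake, hs]

theorem Quiet.wake_add_lt {τ P : ℕ} (h : Quiet A ω τ P) {v : Fin n}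
    (hv : v ∈ (config A ω τ).active) : (config A ω τ).wake v + P < τ :=
  h.1 v _ (wakeTime_mono (Nat.le_add_right _ _) (wakeTime_eq_some_wake hv))

theorem Quiet.wakeTime_eq {τ P t : ℕ} (h : Quiet A ω τ P) (h1 : τ ≤ t) (h2 : t < τ + P)
    (v : Fin n) : (config A ω t).wakeTime v = (config A ω τ).wakeTime v := by
  cases hv : (config A ω t).wakeTime v with
  | some s =>
    have := h.1 v s (wakeTime_mono h2.le hv)
    exact (wakeTime_eq_of_lt hv (by omega)).symm
  | none =>
    cases hv' : (config A ω τ).wakeTime v with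
    | some s => rw [wakeTime_mono h1 hv'] at hv; exact absurd hv (by simp)
    | none => rfl

theorem Quiet.succTime_eq {τ P t : ℕ} (h : Quiet A ω τ P) (h1 : τ ≤ t) (h2 : t < τ + P)
    (v : Fin n) : (config A ω t).succTime v = (config A ω τ).succTime v := by
  cases hv : (config A ω t).succTime v with
  | some s =>
    have h3 := exists_succeedsAt hv
    have h4 := succTime_lt hv
    have := h.2 v s h3
    exact (succTime_mono (show s + 1 ≤ τ by omega) h3).symm
  | none =>
    cases hv' : (config A ω τ).succTime v with
    | some s => rw [succTime_mono h1 hv'] at hv; exact absurd hv (by simp)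
    | none => rfl

theorem Quiet.contention_eq {τ P t : ℕ} (h : Quiet A ω τ P) (h1 : τ ≤ t) (h2 : t < τ + P) :
    D.contention (config A ω t) t =
      ∑ v ∈ (config A ω τ).active, D.grabProb t ((config A ω τ).wake v) := by
  have e1 : (config A ω t).wakeTime = (config A ω τ).wakeTime := funext (h.wakeTime_eq h1 h2)
  have e2 : (config A ω t).succTime = (config A ω τ).succTime := funext (h.succTime_eq h1 h2)
  unfold Protocol.contention Config.active Config.wake
  rw [e1, e2]

/-- The grab probabilities of the protocol of the theorem. -/
def Protocol.IsEliasProtocol (D : Protocol) : Prop :=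
  ∀ s t : ℕ, s < t → D.grabProb t s = min (1 / 2 : ℝ) ((2 : ℝ) ^ (elias' t) / ((t : ℝ) - (s : ℝ)))

theorem Quiet.contention_le (hD : D.IsEliasProtocol) {τ P t : ℕ} (h : Quiet A ω τ P) (h1 : τ ≤ t)
    (h2 : t < τ + P) :
    D.contention (config A ω t) t ≤ (2 : ℝ) ^ elias' t * (config A ω τ).load τ := by
  rw [h.contention_eq h1 h2, Config.load, Finset.mul_sum]
  refine Finset.sum_le_sum fun v hv => ?_
  have h3 := h.wake_add_lt hv
  have h4 : ((config A ω τ).wake v : ℝ) < τ := by exact_mod_cast (by omega)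
  have h5 : (τ : ℝ) ≤ t := by exact_mod_cast h1
  rw [hD _ _ (by omega)]
  refine (min_le_right _ _).trans ?_
  rw [div_eq_mul_inv]
  gcongr

/-- Ages exceed `P` at time `τ`, so they at most double within the window. By `h3` every summand is
at most 2, so a quarter of it respects the cap `1 / 2` on grab probabilities. -/
theorem Quiet.le_contention (hD : D.IsEliasProtocol) {τ P t : ℕ} (h : Quiet A ω τ P) (h1 : τ ≤ t)
    (h2 : t < τ + P) (h3 : (2 : ℝ) ^ elias' t * (config A ω τ).load τ ≤ 2) :
    (2 : ℝ) ^ elias' t * (config A ω τ).load τ / 4 ≤ D.contention (config A ω t) t := by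
  have hpos : (0 : ℝ) < 2 ^ elias' t := by positivity
  have hage : ∀ v ∈ (config A ω τ).active, 0 < (τ : ℝ) - (config A ω τ).wake v := fun v hv => by
    have := h.wake_add_lt hv
    rw [sub_pos]
    exact_mod_cast (by omega)
  rw [h.contention_eq h1 h2, Config.load, Finset.mul_sum, Finset.sum_div]
  refine Finset.sum_le_sum fun v hv => ?_
  have h4 := h.wake_add_lt hv
  have h5 : ((t : ℝ) - (config A ω τ).wake v) ≤ 2 * ((τ : ℝ) - (config A ω τ).wake v) := by
    have : (t : ℝ) + (config A ω τ).wake v ≤ 2 * τ := by exact_mod_cast (by omega)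
    linarith
  have h6 : (0 : ℝ) < (t : ℝ) - (config A ω τ).wake v := by
    rw [sub_pos]; exact_mod_cast (by omega)
  have h7 : (2 : ℝ) ^ elias' t * ((τ : ℝ) - (config A ω τ).wake v)⁻¹ ≤ 2 := by
    refine le_trans (mul_le_mul_of_nonneg_left ?_ hpos.le) h3
    exact Finset.single_le_sum (f := fun v => ((τ : ℝ) - (config A ω τ).wake v)⁻¹)
      (fun w hw => (inv_pos.2 (hage w hw)).le) hv
  rw [hD _ _ (by omega)]
  refine le_min (by linarith) ?_
  rw [← div_eq_mul_inv] at h7 ⊢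
  calc (2 : ℝ) ^ elias' t / ((τ : ℝ) - (config A ω τ).wake v) / 4
      ≤ (2 : ℝ) ^ elias' t / ((τ : ℝ) - (config A ω τ).wake v) / 2 := by
        have := div_pos hpos (hage v hv); linarith
    _ = (2 : ℝ) ^ elias' t / (2 * ((τ : ℝ) - (config A ω τ).wake v)) := by
        rw [div_div, mul_comm]
    _ ≤ _ := by gcongr

theorem Quiet.exists_moderate (hD : D.IsEliasProtocol) {τ P K : ℕ} (h : Quiet A ω τ P)
    (hP : ∀ z : ℤ, z.natAbs ≤ K → ∀ t₀, ∃ t, t₀ ≤ t ∧ t < t₀ + P ∧ elias' t = z)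
    (h1 : ((2 : ℝ) ^ K)⁻¹ ≤ (config A ω τ).load τ) (h2 : (config A ω τ).load τ ≤ 2 ^ K) :
    ∃ t, τ ≤ t ∧ t < τ + P ∧ config A ω t ∈ D.moderate n t := by
  set H := (config A ω τ).load τ with hH
  have hpos : 0 < H := lt_of_lt_of_le (by positivity) h1
  have hl := Int.zpow_log_le_self (b := 2) (by norm_num) hpos
  have hu := Int.lt_zpow_succ_log_self (b := 2) (by norm_num) H
  have hz1 : -(K : ℤ) ≤ Int.log 2 H := by
    rw [← Int.zpow_le_iff_le_log (by norm_num) hpos]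
    simpa using h1
  have hz2 : Int.log 2 H ≤ K := by
    have : Int.log 2 H < (K : ℤ) + 1 := by
      rw [← Int.lt_zpow_iff_log_lt (by norm_num) hpos]
      refine h2.trans_lt ?_
      norm_cast
      exact Nat.pow_lt_pow_right (by norm_num) (by omega)
    omega
  -- This value of `a'` scales the load into `[1, 2]`.
  obtain ⟨t, ht1, ht2, ht⟩ := hP (-Int.log 2 H) (by omega) τ
  have h2z : (0 : ℝ) < 2 ^ Int.log 2 H := by positivity
  push_cast at hl hu
  rw [zpow_add_one₀ (by norm_num)] at hu
  have e : (2 : ℝ) ^ elias' t * H = H / 2 ^ Int.log 2 H := by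
    rw [ht, zpow_neg, mul_comm, div_eq_mul_inv]
  have hge : 1 ≤ (2 : ℝ) ^ elias' t * H := by rw [e, one_le_div h2z]; exact hl
  have hle : (2 : ℝ) ^ elias' t * H ≤ 2 := by rw [e, div_le_iff₀ h2z]; linarith
  refine ⟨t, ht1, ht2, ?_, (h.contention_le hD ht1 ht2).trans hle⟩
  have := h.le_contention hD ht1 ht2 hle
  linarith

theorem Quiet.exists_favorable (hD : D.IsEliasProtocol) {τ P K T : ℕ} (h : Quiet A ω τ P)
    (hP : ∀ z : ℤ, z.natAbs ≤ K → ∀ t₀, ∃ t, t₀ ≤ t ∧ t < t₀ + P ∧ elias' t = z)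
    (h1 : (config A ω τ).load τ ≤ ((2 : ℝ) ^ K)⁻¹) {u : Fin n}
    (hu : u ∈ (config A ω τ).active) (hT : τ + P ≤ (config A ω τ).wake u + T + 1) {p : ℝ}
    (hp : p ≤ 1 / 2) (hpT : p * T ≤ 2 ^ K) :
    ∃ t, τ ≤ t ∧ t < τ + P ∧ config A ω t ∈ D.favorable u p t := by
  obtain ⟨t, ht1, ht2, ht⟩ := hP K (by simp) τ
  have hlt := h.wake_add_lt hu
  have hw : (config A ω t).wake u = (config A ω τ).wake u := by
    rw [Config.wake, Config.wake, h.wakeTime_eq ht1 ht2]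
  refine ⟨t, ht1, ht2, ?_, ?_, ?_⟩
  · rw [Config.mem_active, h.wakeTime_eq ht1 ht2, h.succTime_eq ht1 ht2]
    exact Config.mem_active.1 hu
  · refine (h.contention_le hD ht1 ht2).trans ?_
    rw [ht, zpow_natCast]
    calc (2 : ℝ) ^ K * (config A ω τ).load τ ≤ 2 ^ K * (2 ^ K)⁻¹ := by gcongr
      _ = 1 := mul_inv_cancel₀ (by positivity)
  · rw [hw, hD _ _ (by omega), ht, zpow_natCast]
    have h0 : (0 : ℝ) < (t : ℝ) - (config A ω τ).wake u := by
      rw [sub_pos]; exact_mod_cast (by omega)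
    have hle : (t : ℝ) - (config A ω τ).wake u ≤ T := by
      have : (t : ℝ) ≤ T + (config A ω τ).wake u := by exact_mod_cast (by omega)
      linarith
    refine le_min hp ?_
    rw [le_div_iff₀ h0]
    rcases le_or_gt p 0 with hp0 | hp0
    · exact (mul_nonpos_of_nonpos_of_nonneg hp0 h0.le).trans (by positivity)
    · exact (mul_le_mul_of_nonneg_left hle hp0.le).trans hpT

/-- The load is high at few of the times `r + j * P`. -/
theorem card_high_load_le {r P J K : ℕ} (hP : 0 < P) (hK : 2 + Real.log J ≤ 2 ^ K)
    {S : Finset ℕ} (hS : S ⊆ Finset.range J)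
    (h : ∀ j ∈ S, (2 : ℝ) ^ K < (config A ω (r + j * P)).load (r + j * P)) : S.card ≤ n := by
  classical
  set τ : ℕ → ℕ := fun j => r + j * P with hτ
  have hτinj : Function.Injective τ := fun i j hij => by
    have := Nat.add_left_cancel hij
    exact Nat.eq_of_mul_eq_mul_right hP this
  -- Double counting: at the sampled times a fixed party has distinct positive ages, so its inverse
  -- ages sum to at most `2 + Real.log J`.
  have hsum : ∑ j ∈ S, (config A ω (τ j)).load (τ j) ≤ n * (2 : ℝ) ^ K := by
    have e : ∀ j, (config A ω (τ j)).load (τ j) = ∑ v : Fin n,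
        if v ∈ (config A ω (τ j)).active then ((τ j : ℝ) - (config A ω (τ j)).wake v)⁻¹ else 0 := by
      intro j
      rw [Config.load, ← Finset.sum_filter]
      congr 1
      ext; simp
    simp only [e]
    rw [Finset.sum_comm]
    refine (Finset.sum_le_card_nsmul _ _ (2 ^ K) fun v _ => ?_).trans (by simp)
    rw [← Finset.sum_filter]
    set S' := S.filter fun j => v ∈ (config A ω (τ j)).active with hS'
    rcases S'.eq_empty_or_nonempty with he | ⟨j₀, hj₀⟩
    · rw [he]; simp
    set w := (config A ω (τ j₀)).wake v with hw
    have hwake : ∀ j ∈ S', (config A ω (τ j)).wakeTime v = some w := by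
      intro j hj
      have h1 := wakeTime_eq_some_wake (Finset.mem_filter.1 hj).2
      have h2 := wakeTime_eq_some_wake (Finset.mem_filter.1 hj₀).2
      rcases le_total (τ j) (τ j₀) with hle | hle
      · rw [h1, ← h2, wakeTime_mono hle h1]
      · exact wakeTime_mono hle h2
    have hlt : ∀ j ∈ S', w < τ j := fun j hj => wakeTime_lt (hwake j hj)
    have hinj : Set.InjOn (fun j => τ j - w) S' := by
      intro i hi j hj hij
      have h1 := hlt i hi
      have h2 := hlt j hj
      simp only at hij
      exact hτinj (by omega)
    calc ∑ j ∈ S', ((τ j : ℝ) - (config A ω (τ j)).wake v)⁻¹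
        = ∑ j ∈ S', (((τ j - w : ℕ) : ℝ))⁻¹ := by
          refine Finset.sum_congr rfl fun j hj => ?_
          rw [Nat.cast_sub (hlt j hj).le, Config.wake, hwake j hj]
          rfl
      _ = ∑ a ∈ S'.image fun j => τ j - w, (a : ℝ)⁻¹ := by
          rw [Finset.sum_image hinj]
      _ ≤ 2 + Real.log J := by
          refine sum_inv_le ?_ ?_
          · refine Finset.card_image_le.trans ((Finset.card_filter_le _ _).trans ?_)
            simpa using Finset.card_le_card hS
          · intro a ha
            obtain ⟨j, hj, rfl⟩ := Finset.mem_image.1 ha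
            have := hlt j hj
            omega
      _ ≤ _ := hK
  have hcard : (S.card : ℝ) * 2 ^ K ≤ n * (2 : ℝ) ^ K := by
    refine le_trans ?_ hsum
    rw [← nsmul_eq_mul]
    exact Finset.card_nsmul_le_sum _ _ _ fun j hj => (h j hj).le
  exact_mod_cast le_of_mul_le_mul_right hcard (by positivity)

-- Each party spoils at most three windows: the one containing its wake-up, the next one, and the
-- one containing its success.
open Classical in
theorem card_not_quiet_le {r P J : ℕ} :
    ((Finset.range J).filter fun j => ¬ Quiet A ω (r + j * P) P).card ≤ 3 * n := by
  let R₁ : Fin n → ℕ → Prop := fun v j => ∃ s, WakesAt A ω v s ∧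
    (r + j * P ≤ s + P ∧ s + P < r + j * P + P)
  let R₂ : Fin n → ℕ → Prop := fun v j => ∃ s, WakesAt A ω v s ∧
    (r + j * P ≤ s ∧ s < r + j * P + P)
  let R₃ : Fin n → ℕ → Prop := fun v j => ∃ t, SucceedsAt A ω v t ∧
    (r + j * P ≤ t ∧ t < r + j * P + P)
  have hw : ∀ v s s', WakesAt A ω v s → WakesAt A ω v s' → s = s' := by
    intro v s s' h h'
    have h1 := wakeTime_mono (le_max_left (s + 1) (s' + 1)) h
    have h2 := wakeTime_mono (le_max_right (s + 1) (s' + 1)) h'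
    simpa using h1.symm.trans h2
  have c₁ : ((Finset.range J).filter fun j => ∃ v, R₁ v j).card ≤ n := by
    refine (card_le_card_of_unique R₁ (fun j hj => (Finset.mem_filter.1 hj).2) ?_).trans (by simp)
    rintro v i j ⟨s, hs, hi⟩ ⟨s', hs', hj⟩
    rw [hw v s' s hs' hs] at hj
    exact window_unique hi hj
  have c₂ : ((Finset.range J).filter fun j => ∃ v, R₂ v j).card ≤ n := by
    refine (card_le_card_of_unique R₂ (fun j hj => (Finset.mem_filter.1 hj).2) ?_).trans (by simp)
    rintro v i j ⟨s, hs, hi⟩ ⟨s', hs', hj⟩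
    rw [hw v s' s hs' hs] at hj
    exact window_unique hi hj
  have c₃ : ((Finset.range J).filter fun j => ∃ v, R₃ v j).card ≤ n := by
    refine (card_le_card_of_unique R₃ (fun j hj => (Finset.mem_filter.1 hj).2) ?_).trans (by simp)
    rintro v i j ⟨s, hs, hi⟩ ⟨s', hs', hj⟩
    rw [succeedsAt_unique hs' hs] at hj
    exact window_unique hi hj
  have hsub : ((Finset.range J).filter fun j => ¬ Quiet A ω (r + j * P) P) ⊆
      ((Finset.range J).filter fun j => ∃ v, R₁ v j) ∪
        (((Finset.range J).filter fun j => ∃ v, R₂ v j) ∪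
          ((Finset.range J).filter fun j => ∃ v, R₃ v j)) := by
    intro j hj
    obtain ⟨hj, hq⟩ := Finset.mem_filter.1 hj
    simp only [Finset.mem_union, Finset.mem_filter, hj, true_and]
    rw [Quiet, not_and_or] at hq
    push Not at hq
    rcases hq with ⟨v, s, hs, hle⟩ | ⟨v, t, ht, h1, h2⟩
    · have hlt := wakeTime_lt hs
      have hs' : WakesAt A ω v s := wakeTime_eq_of_lt hs (Nat.lt_succ_self s)
      rcases lt_or_ge s (r + j * P) with h | h
      · exact Or.inl ⟨v, s, hs', hle, by omega⟩
      · exact Or.inr (Or.inl ⟨v, s, hs', h, hlt⟩)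
    · exact Or.inr (Or.inr ⟨v, t, ht, h1, h2⟩)
  have h1 := Finset.card_le_card hsub
  have h2 := Finset.card_union_le ((Finset.range J).filter fun j => ∃ v, R₁ v j)
    (((Finset.range J).filter fun j => ∃ v, R₂ v j) ∪
          ((Finset.range J).filter fun j => ∃ v, R₃ v j))
  have h3 := Finset.card_union_le ((Finset.range J).filter fun j => ∃ v, R₂ v j)
    ((Finset.range J).filter fun j => ∃ v, R₃ v j)
  omega

theorem exists_succeedsAt_of_hits_lt (hD : D.IsEliasProtocol) {P K J M₁ M₂ : ℕ} {p : ℝ}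
    (hP : ∀ z : ℤ, z.natAbs ≤ K → ∀ t₀, ∃ t, t₀ ≤ t ∧ t < t₀ + P ∧ elias' t = z)
    (hK : 2 + Real.log J ≤ 2 ^ K) (hp : p ≤ 1 / 2) (hpT : p * (J * P : ℕ) ≤ 2 ^ K)
    (hJ : 4 * n + M₁ + M₂ ≤ J) {u : Fin n}
    (h1 : ∀ T, hits (fun t => {ω | config A ω t ∈ D.moderate n t}) ω T < M₁)
    (h2 : ∀ T, hits (fun t => {ω | config A ω t ∈ D.favorable u p t}) ω T < M₂)
    {s : ℕ} (hs : WakesAt A ω u s) : ∃ t, SucceedsAt A ω u t ∧ t ≤ s + J * P := by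
  classical
  by_contra hno
  push Not at hno
  have hP0 : 0 < P := by
    obtain ⟨t, h3, h4, -⟩ := hP 0 (by simp) 0
    omega
  -- The windows start with the first slot in which `u` may grab, and all their slots are at most `s
  -- + J * P`, so `u` stays active throughout by `hno`.
  set r := s + 1 with hr
  have hend : ∀ j ∈ Finset.range J, r + j * P + P ≤ s + J * P + 1 := by
    intro j hj
    have := Nat.mul_le_mul_right P (Nat.succ_le_of_lt (Finset.mem_range.1 hj))
    rw [Nat.succ_mul] at this
    omega
  have hact : ∀ j ∈ Finset.range J, u ∈ (config A ω (r + j * P)).active ∧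
      (config A ω (r + j * P)).wake u = s := by
    intro j hj
    have h3 : (config A ω (r + j * P)).wakeTime u = some s := wakeTime_mono (by omega) hs
    refine ⟨Config.mem_active.2 ⟨by simp [h3], ?_⟩, by simp [Config.wake, h3]⟩
    cases hv : (config A ω (r + j * P)).succTime u with
    | none => rfl
    | some t =>
      have h4 := hno t (exists_succeedsAt hv)
      have h5 := succTime_lt hv
      have h6 := hend j hj
      omega
  set N := (Finset.range J).filter fun j => ¬ Quiet A ω (r + j * P) P with hN
  set Q := (Finset.range J).filter fun j => Quiet A ω (r + j * P) P with hQ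
  set Qh := Q.filter fun j => (2 : ℝ) ^ K < (config A ω (r + j * P)).load (r + j * P) with hQh
  set Q' := Q.filter fun j => ¬ (2 : ℝ) ^ K < (config A ω (r + j * P)).load (r + j * P) with hQ'
  set Qm := Q'.filter fun j => ((2 : ℝ) ^ K)⁻¹ ≤ (config A ω (r + j * P)).load (r + j * P) with hQm
  set Ql := Q'.filter fun j => ¬ ((2 : ℝ) ^ K)⁻¹ ≤ (config A ω (r + j * P)).load (r + j * P)
    with hQl
  have s1 : Q.card + N.card = J := by
    rw [hQ, hN, Finset.card_filter_add_card_filter_not]; simp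
  have s2 : Qh.card + Q'.card = Q.card := Finset.card_filter_add_card_filter_not _
  have s3 : Qm.card + Ql.card = Q'.card := Finset.card_filter_add_card_filter_not _
  have cN : N.card ≤ 3 * n := card_not_quiet_le
  have ch : Qh.card ≤ n := by
    refine card_high_load_le hP0 hK ?_ fun j hj => (Finset.mem_filter.1 hj).2
    exact (Finset.filter_subset _ _).trans (Finset.filter_subset _ _)
  have cm : Qm.card < M₁ := by
    refine lt_of_le_of_lt (card_le_hits (fun t j => r + j * P ≤ t ∧ t < r + j * P + P) ?_
      fun t i j hi hj => window_unique hi hj) (h1 (s + J * P + 1))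
    intro j hj
    obtain ⟨hj, hl⟩ := Finset.mem_filter.1 hj
    obtain ⟨hj, hu⟩ := Finset.mem_filter.1 hj
    obtain ⟨hj, hq⟩ := Finset.mem_filter.1 hj
    obtain ⟨t, ht1, ht2, ht⟩ := hq.exists_moderate hD hP hl (not_lt.1 hu)
    exact ⟨t, by have := hend j hj; omega, ⟨ht1, ht2⟩, ht⟩
  have cl : Ql.card < M₂ := by
    refine lt_of_le_of_lt (card_le_hits (fun t j => r + j * P ≤ t ∧ t < r + j * P + P) ?_
      fun t i j hi hj => window_unique hi hj) (h2 (s + J * P + 1))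
    intro j hj
    obtain ⟨hj, hl⟩ := Finset.mem_filter.1 hj
    obtain ⟨hj, hu⟩ := Finset.mem_filter.1 hj
    obtain ⟨hj, hq⟩ := Finset.mem_filter.1 hj
    have hend := hend j hj
    obtain ⟨ha, hw⟩ := hact j hj
    obtain ⟨t, ht1, ht2, ht⟩ := hq.exists_favorable hD hP (not_le.1 hl).le ha
      (T := J * P) (by rw [hw]; exact hend) hp hpT
    exact ⟨t, by omega, ⟨ht1, ht2⟩, ht⟩
  -- The four classes of windows together number fewer than `3 n + n + M₁ + M₂ ≤ J`, a
  -- contradiction.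
  omega

end Windows

/-! ### The protocol -/

/-- The grab probability at local time `i + 1` of a party woken up at time `s`. -/
noncomputable def eliasProb (s i : ℕ) : unitInterval :=
  ⟨min (1 / 2) ((2 : ℝ) ^ elias' (s + i + 1) / ((i : ℝ) + 1)), le_min (by norm_num) (by positivity),
    (min_le_left _ _).trans (by norm_num)⟩

/-- The protocol with independent bits and grab probabilities `eliasProb`. -/
noncomputable def eliasProtocol : Protocol where
  law s := Measure.infinitePi fun i => bernoulliMeasure true false (eliasProb s i)
  isProbabilityMeasure_law _ := inferInstance

theorem eliasProtocol_memoryless : eliasProtocol.Memoryless := fun _ =>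
  iIndepFun_infinitePi (X := fun _ x => x) fun _ => measurable_id

theorem eliasProtocol_isEliasProtocol : eliasProtocol.IsEliasProtocol := by
  intro s t hst
  have h := (measurePreserving_eval_infinitePi
    (fun i => bernoulliMeasure true false (eliasProb s i)) (t - s - 1)).measureReal_preimage
    (s := {true}) (measurableSet_singleton true).nullMeasurableSet
  rw [Protocol.grabProb]
  have e : s + (t - s - 1) + 1 = t := by omega
  have e' : ((t - s - 1 : ℕ) : ℝ) + 1 = (t : ℝ) - s := by
    rw [← Nat.cast_sub hst.le, ← Nat.cast_add_one]; congr 1; omega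
  refine Eq.trans h ?_
  rw [bernoulliMeasure_real_apply _ (measurableSet_singleton true)]
  simp [eliasProb, e, e']

/-! ### The latency -/

theorem Protocol.hasLatency_of_le {D : Protocol} (hm : D.Memoryless) (hD : D.IsEliasProtocol)
    {n P K J M₁ M₂ : ℕ} {p : ℝ}
    (hP : ∀ z : ℤ, z.natAbs ≤ K → ∀ t₀, ∃ t, t₀ ≤ t ∧ t < t₀ + P ∧ elias' t = z)
    (hK : 2 + Real.log J ≤ 2 ^ K) (hp0 : 0 ≤ p) (hp : p ≤ 1 / 2) (hpT : p * (J * P : ℕ) ≤ 2 ^ K)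
    (hJ : 4 * n + M₁ + M₂ ≤ J) {L q : ℝ} (hL : ((J * P : ℕ) : ℝ) ≤ L)
    (hq : Real.exp (n - 1 / 512 / 2 * M₁) + Real.exp (1 - p / 8 / 2 * M₂) ≤ q) :
    D.HasLatency n L q := by
  intro A u
  have hhalf : ∀ t s, s < t → D.grabProb t s ≤ 1 / 2 := fun t s hst => by
    rw [hD s t hst]; exact min_le_left _ _
  set E₁ := {ω | ∃ T, M₁ ≤ hits (fun t => {ω | config A ω t ∈ D.moderate n t}) ω T} with hE₁
  set E₂ := {ω | ∃ T, M₂ ≤ hits (fun t => {ω | config A ω t ∈ D.favorable u p t}) ω T} with hE₂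
  have h1 : (D.prob n).real E₁ ≤ Real.exp (n - 1 / 512 / 2 * M₁) :=
    ENNReal.toReal_le_of_le_ofReal (Real.exp_pos _).le (prob_moderate_le hm hhalf A M₁)
  have h2 : (D.prob n).real E₂ ≤ Real.exp (1 - p / 8 / 2 * M₂) :=
    ENNReal.toReal_le_of_le_ofReal (Real.exp_pos _).le (prob_favorable_le hm hhalf A u hp0 M₂)
  -- Covering the whole space and using subadditivity avoids any measurability claim about the
  -- latency event.
  have hcover : (Set.univ : Set (Strings n)) ⊆ {ω | LatencyLE A ω u L} ∪ (E₁ ∪ E₂) := by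
    intro ω _
    by_cases hω₁ : ω ∈ E₁
    · exact Or.inr (Or.inl hω₁)
    by_cases hω₂ : ω ∈ E₂
    · exact Or.inr (Or.inr hω₂)
    refine Or.inl fun s hs => ?_
    obtain ⟨t, ht, hle⟩ := exists_succeedsAt_of_hits_lt hD hP hK hp hpT hJ
      (fun T => not_le.1 fun h => hω₁ ⟨T, h⟩) (fun T => not_le.1 fun h => hω₂ ⟨T, h⟩) hs
    refine ⟨t, ht, le_trans ?_ hL⟩
    have : (t : ℝ) ≤ s + (J * P : ℕ) := by exact_mod_cast hle
    linarith
  have h3 := (measureReal_mono (μ := D.prob n) hcover).trans (measureReal_union_le _ _)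
  have h4 := measureReal_union_le (μ := D.prob n) E₁ E₂
  rw [probReal_univ] at h3
  linarith

/-! ### Choice of the parameters for large `n` -/

theorem logb_two_le_two_mul_log {x : ℝ} (hx : 1 ≤ x) : Real.logb 2 x ≤ 2 * Real.log x := by
  have h := Real.log_two_gt_d9
  rw [Real.logb, div_le_iff₀ (by linarith)]
  nlinarith [Real.log_nonneg hx]

theorem eventually_zeta_le {κ : ℝ} (hκ : 0 < κ) :
    ∀ᶠ l : ℝ in atTop, zeta (4 * Real.logb 2 l) ≤ κ * l := by
  have h1 : ∀ᶠ l : ℝ in atTop, Real.log l ^ 11 ≤ κ / (2 * 8 ^ 11) * l := by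
    filter_upwards [(Real.isLittleO_pow_log_id_atTop (n := 11)).bound
      (show 0 < κ / (2 * 8 ^ 11) by positivity), eventually_ge_atTop 0] with l hl hl0
    refine (le_abs_self _).trans ?_
    simpa [abs_of_nonneg hl0] using hl
  filter_upwards [h1, eventually_ge_atTop 2] with l hl h2
  have h3 := one_le_logb_two h2
  calc zeta (4 * Real.logb 2 l) ≤ 2 * (4 * Real.logb 2 l) ^ 11 := zeta_le_pow (by linarith)
    _ ≤ 2 * (4 * (2 * Real.log l)) ^ 11 := by
        gcongr; exact logb_two_le_two_mul_log (by linarith)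
    _ = 2 * 8 ^ 11 * Real.log l ^ 11 := by ring
    _ ≤ 2 * 8 ^ 11 * (κ / (2 * 8 ^ 11) * l) := by gcongr
    _ = κ * l := by field_simp

theorem hasLatency_of_large {D : Protocol} (hm : D.Memoryless) (hD : D.IsEliasProtocol) {c : ℝ}
    (hc : 0 < c) {n : ℕ} {l : ℝ} (hl : l = Real.logb 2 n) (hl100 : 100 ≤ l)
    (hzeta : zeta (4 * Real.logb 2 l) ≤ (131392 * (c + 2))⁻¹ * l)
    (hsq : Real.log n ^ 2 ≤ n) (hlin : (c + 1) * Real.log n ≤ n) :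
    D.HasLatency n (2053 * ((n : ℝ) * zeta (4 * Real.logb 2 l))) ((n : ℝ) ^ (-c)) := by
  set y := Real.logb 2 l with hy
  set ζ := zeta (4 * y) with hζ
  have hl0 : 0 < l := by linarith
  have hy1 : 1 ≤ y := one_le_logb_two (by linarith)
  have hζ1 : 1 ≤ ζ := by
    have := two_mul_le_zeta (show 1 ≤ 4 * y by linarith); linarith
  have hn2 : 2 ≤ n := by
    by_contra hcon
    have : n = 0 ∨ n = 1 := by omega
    rcases this with rfl | rfl <;> simp at hl <;> linarith
  have hn0 : (0 : ℝ) < n := by exact_mod_cast (by omega)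
  have hn2' : (2 : ℝ) ≤ n := by exact_mod_cast hn2
  have hlogn : 0 ≤ Real.log n := Real.log_nonneg (by linarith)
  have hl_le : l ≤ 2 * Real.log n := hl ▸ logb_two_le_two_mul_log (by linarith)
  have hlog_le : Real.log n ≤ l := by
    rw [hl, Real.logb, le_div_iff₀ (Real.log_pos (by norm_num))]
    nlinarith [Real.log_two_lt_d9]
  -- The largest `K` with `2 * K + 1 ≤ 4 * y`, so that codes of all integers of modulus at most `K`
  -- fit into period `ζ(4y)`. It still satisfies `2 ^ K ≥ l ^ 2 / 4`.
  set K := ⌊2 * y - 1 / 2⌋₊ with hKdef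
  have hK1 : (K : ℝ) ≤ 2 * y - 1 / 2 := Nat.floor_le (by linarith)
  have hK2 : 2 * y - 1 / 2 < K + 1 := Nat.lt_floor_add_one _
  have hpow : l ^ 2 / 4 ≤ (2 : ℝ) ^ K := by
    have e : l ^ 2 / 4 = (2 : ℝ) ^ (2 * y - 2) := by
      rw [Real.rpow_sub (by norm_num), mul_comm, Real.rpow_mul (by norm_num), hy,
        Real.rpow_logb (by norm_num) (by norm_num) hl0]
      norm_num
    rw [e, ← Real.rpow_natCast]
    exact Real.rpow_le_rpow_of_exponent_le (by norm_num) (by linarith)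
  set P := ⌊ζ⌋₊ with hPdef
  have hPle : (P : ℝ) ≤ ζ := Nat.floor_le (by linarith)
  have hP : ∀ z : ℤ, z.natAbs ≤ K → ∀ t₀, ∃ t, t₀ ≤ t ∧ t < t₀ + P ∧ elias' t = z := by
    intro z hz t₀
    have hz' : (z.natAbs : ℝ) ≤ K := by exact_mod_cast hz
    obtain ⟨p, hp, h⟩ := exists_period z (show 1 ≤ 4 * y by linarith) (by linarith)
    obtain ⟨t, h1, h2, h3⟩ := h t₀
    have : p ≤ P := Nat.le_floor hp
    exact ⟨t, h1, by omega, h3⟩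
  -- With the crude bound `log 2053 ≤ 2052` it suffices that `2054 + l ≤ l ^ 2 / 4`, which holds for
  -- `l ≥ 100`.
  have hlogJ : 2 + Real.log ((2053 * n : ℕ) : ℝ) ≤ 2 ^ K := by
    refine le_trans ?_ hpow
    push_cast
    rw [Real.log_mul (by norm_num) hn0.ne']
    have := Real.log_le_sub_one_of_pos (show (0 : ℝ) < 2053 by norm_num)
    nlinarith
  have hT : ((2053 * n * P : ℕ) : ℝ) ≤ 2053 * (n * ζ) := by
    push_cast
    rw [mul_assoc]
    gcongr
  set p := l ^ 2 / 4 / (2053 * (n * ζ)) with hpdef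
  have hp0 : 0 ≤ p := by positivity
  -- With `M₁ = 2048 n` the first exponent is `n - 2n = -n`, and `4n + 2048n + n = 2053n` windows
  -- suffice.
  refine Protocol.hasLatency_of_le hm hD (M₁ := 2048 * n) (M₂ := n) hP hlogJ hp0 ?_ ?_ (by omega)
    hT ?_
  · rw [hpdef, div_le_iff₀ (by positivity)]
    have : (n : ℝ) ≤ n * ζ := le_mul_of_one_le_right hn0.le hζ1
    nlinarith
  · calc p * ((2053 * n * P : ℕ) : ℝ) ≤ p * (2053 * (n * ζ)) := by gcongr
      _ = l ^ 2 / 4 := div_mul_cancel₀ _ (by positivity)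
      _ ≤ _ := hpow
  · have hbound : ∀ a : ℝ, a ≤ -((c + 1) * Real.log n) → Real.exp a ≤ (n : ℝ) ^ (-c) / 2 := by
      intro a ha
      calc Real.exp a ≤ Real.exp (-((c + 1) * Real.log n)) := Real.exp_le_exp.2 ha
        _ = (n : ℝ) ^ (-c) / n := by
          rw [← Real.rpow_sub_one hn0.ne', Real.rpow_def_of_pos hn0]
          congr 1; ring
        _ ≤ _ := by gcongr
    have h1 := hbound (n - 1 / 512 / 2 * (2048 * n : ℕ)) (by push_cast; linarith)
    have h2 := hbound (1 - p / 8 / 2 * n) (by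
      -- Here `131392 = 4 * 16 * 2053`; the bound `hzeta` on `ζ` makes this at least `(c + 2) * l`.
      have e : p / 8 / 2 * n = l ^ 2 / (131392 * ζ) := by
        rw [hpdef]; field_simp; norm_num
      have h3 : (c + 2) * l ≤ l ^ 2 / (131392 * ζ) := by
        rw [le_div_iff₀ (by positivity)]
        calc (c + 2) * l * (131392 * ζ) = 131392 * (c + 2) * l * ζ := by ring
          _ ≤ 131392 * (c + 2) * l * ((131392 * (c + 2))⁻¹ * l) := by gcongr
          _ = l ^ 2 := by field_simp
      rw [e]
      nlinarith)
    linarith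

theorem exists_hasLatency {D : Protocol} (hm : D.Memoryless) (hD : D.IsEliasProtocol) (c : ℝ)
    (hc : 0 < c) : ∃ C : ℝ, 0 < C ∧ ∃ n₀ : ℕ, ∀ n : ℕ, n₀ ≤ n →
      D.HasLatency n (C * ((n : ℝ) * zeta (4 * Real.logb 2 (Real.logb 2 n)))) ((n : ℝ) ^ (-c)) := by
  have hlog : Tendsto (fun n : ℕ => Real.logb 2 n) atTop atTop :=
    (Real.tendsto_logb_atTop (by norm_num)).comp tendsto_natCast_atTop_atTop
  have hpow : ∀ (k : ℕ) (κ : ℝ), 0 < κ → ∀ᶠ n : ℕ in atTop, Real.log n ^ k ≤ κ * n := by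
    intro k κ hκ
    filter_upwards [tendsto_natCast_atTop_atTop.eventually
      ((Real.isLittleO_pow_log_id_atTop (n := k)).bound hκ)] with n hn
    refine (le_abs_self _).trans ?_
    simpa using hn
  refine ⟨2053, by norm_num, eventually_atTop.1 ?_⟩
  filter_upwards [hlog.eventually_ge_atTop 100,
    hlog.eventually (eventually_zeta_le (show 0 < (131392 * (c + 2))⁻¹ by positivity)),
    hpow 2 1 one_pos, hpow 1 (c + 1)⁻¹ (by positivity)] with n h1 h2 h3 h4
  refine hasLatency_of_large hm hD hc rfl h1 h2 (by simpa using h3) ?_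
  rw [pow_one, inv_mul_eq_div, le_div_iff₀ (by positivity)] at h4
  linarith

theorem exists_period_elias' (z : ℤ) : ∃ p : ℕ, ∀ t₀ : ℕ, ∃ t : ℕ,
    t₀ ≤ t ∧ t < t₀ + p ∧ elias' t = z := by
  obtain ⟨p, -, hp⟩ := exists_period z (x := 2 * z.natAbs + 1)
    (by linarith [Nat.cast_nonneg (α := ℝ) z.natAbs]) le_rfl
  exact ⟨p, hp⟩

end ContentionResolution

theorem mainTheorem2 :
    ∃ D : ContentionResolution.Protocol,
      D.Memoryless ∧
      (∀ s t : ℕ, s < t →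
        D.grabProb t s =
          min (1 / 2 : ℝ) ((2 : ℝ) ^ (ContentionResolution.elias' t) / ((t : ℝ) - (s : ℝ)))) ∧
      (∀ z : ℤ, ∃ p : ℕ, ∀ t₀ : ℕ, ∃ t : ℕ,
        t₀ ≤ t ∧ t < t₀ + p ∧ ContentionResolution.elias' t = z) ∧
      (∀ c : ℝ, 0 < c → ∃ C : ℝ, 0 < C ∧ ∃ n₀ : ℕ, ∀ n : ℕ, n₀ ≤ n →
        D.HasLatency n
          (C * ((n : ℝ) * ContentionResolution.zeta (4 * Real.logb 2 (Real.logb 2 n))))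
          ((n : ℝ) ^ (-c))) ∧
      (∀ C : ℝ, 0 < C → ∃ ε : ℕ → ℝ, Tendsto ε atTop (𝓝 0) ∧ ∀ᶠ n : ℕ in atTop,
        C * ((n : ℝ) * ContentionResolution.zeta (4 * Real.logb 2 (Real.logb 2 n))) =
          (n : ℝ) * (Real.logb 2 (Real.logb 2 n)) ^ (1 + ε n)) :=
  ⟨ContentionResolution.eliasProtocol, ContentionResolution.eliasProtocol_memoryless,
    ContentionResolution.eliasProtocol_isEliasProtocol, ContentionResolution.exists_period_elias',
    ContentionResolution.exists_hasLatency ContentionResolution.eliasProtocol_memoryless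
      ContentionResolution.eliasProtocol_isEliasProtocol,
    ContentionResolution.exists_exponent⟩
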